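/- For a finite graph $G$ let $\mu(G)$ be the largest eigenvalue of its adjacency matrix, and let $P_l$ be the path with $l$ vertices. For $1\le k<n$ let $S_{n,k}=K_k\vee\overline{K}_{n-k}$ be the join of the complete graph of order $k$ and the edgeless graph of order $n-k$, and, for $n\ge k+2$, let $S^+_{n,k}$ be the graph obtained from $S_{n,k}$ by adding one edge inside its independent set of order $n-k$. Let $h_l(n)=\max\{\mu(G): |G|=n,\ P_l\nsubseteq G\}$, where containment is as a not necessarily induced subgraph. Let $k\ge 1$, $n\ge 2^{4k}$, and let $G$ be a graph of order $n$. (a) If $\mu(G)\ge\mu(S_{n,k})$, then $G$ contains a $P_{2k+2}$ unless $G=S_{n,k}$ (up to isomorphism). (b) If $\mu(G)\ge\mu(S^+_{n,k})$, then $G$ contains a $P_{2k+3}$ unless $G=S^+_{n,k}$ (up to isomorphism). Consequently, for every $k\ge1$ and $n\ge 2^{4k}$, $h_{2k+2}(n)=\mu(S_{n,k})$ and $h_{2k+3}(n)=\mu(S^+_{n,k})$. -/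

import Mathlib

open Classical in
/-- The largest eigenvalue `μ(G)` of the adjacency matrix of a finite graph `G`
(with a nonempty vertex set). -/
noncomputable def graphMu {V : Type*} [Fintype V] (G : SimpleGraph V) : ℝ :=
  sSup {x : ℝ | Module.End.HasEigenvalue (G.adjMatrix ℝ).mulVecLin x}

/-- `G` contains (as a not necessarily induced subgraph) a path with `m` vertices. -/
def ContainsPath {V : Type*} (m : ℕ) (G : SimpleGraph V) : Prop :=
  (SimpleGraph.pathGraph m).IsContained G

/-- The graph `S_{n,k}`: the vertices `0, …, k-1` form a complete graph, the vertices
`k, …, n-1` form an independent set, and all edges between the two parts are present. -/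
def graphS (n k : ℕ) : SimpleGraph (Fin n) :=
  SimpleGraph.fromRel (fun i _ => i.val < k)

/-- The graph `S⁺_{n,k}`: the graph `S_{n,k}` with one added edge, joining the vertices `k` and
`k+1` of the independent set (for `k + 2 ≤ n`). -/
def graphSPlus (n k : ℕ) : SimpleGraph (Fin n) :=
  graphS n k ⊔ SimpleGraph.fromRel (fun i j => i.val = k ∧ j.val = k + 1)

/-- The set of the values `μ(G)` over all graphs `G` of order `n` that contain no path of order
`l`; its maximum is `h_l(n)`. -/
def pathFreeMuSet (l n : ℕ) : Set ℝ :=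
  {x | ∃ G : SimpleGraph (Fin n), ¬ ContainsPath l G ∧ graphMu G = x}

/-! Suppose that `G` has no path of the forbidden order and put `c = graphMu G`; it has to be shown
that `G` is the extremal graph. The positive root `r` of `r² - (k-1) r = k (n-k)` is an eigenvalue
of the join, so `c ≥ r` gives `c² - (k-1) c ≥ k (n-k)`. Averaging the vector `A²1 - (k-1) A1` with
the weights of a nonnegative eigenvector `x` turns this into a local statement: some `u` with `x u >
0` has neighbours whose degrees sum to at least `k (n-k) + (k-1) deg u`.

For `k ≥ 2` this count forces a large biclique (`exists_biclique`). A set `X` maximising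
`corePotential` spans, with `u`, a graph of edges touching the neighbourhood of `u`, in which
vertices other than `u` have degree at least `k` and no two adjacent ones have degree `k`. Detours
from a longest path `P` show that the vertices off `P` are independent with at most `k` neighbours,
all inside `P` (`exists_small_cover`). The potential then makes `X \ P` exceed `(k+2) 4^k` vertices,
and the pigeonhole principle gives at least `k + 3` of them with the same `k` neighbours `L`.

A zigzag through the biclique has `2k` vertices, so only very short paths outside `L` may be
attached to `L`. If `P_{2k+2}` is forbidden, every edge in the part of `G` reached from `L` meets
`L`, and a Rayleigh quotient comparison yields equality (`eq_joinGraph`). If `P_{2k+3}` is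
forbidden, what is left outside `L` consists of stars and single edges; if it is more than one edge,
summing the eigenvalue equations over `L` gives `c² - (k-1) c ≤ k (n-k)`, which contradicts the
strict inequality `graphMu (graphS n k) < c` (`eq_joinPlus`). -/

section Spectral

/-! ### Rayleigh quotients, Perron vectors and comparison of graphs. -/

open Classical in
/-- The action of the adjacency matrix: the sum of `v` over the neighbours of `i`. -/
noncomputable def nbrSum {V : Type*} [Fintype V] (G : SimpleGraph V) (v : V → ℝ) (i : V) : ℝ :=
  ∑ j, if G.Adj i j then v j else 0

variable {V : Type*} [Fintype V]

theorem adjForm_comm (G : SimpleGraph V) (v w : V → ℝ) :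
    ∑ i, v i * nbrSum G w i = ∑ i, w i * nbrSum G v i := by
  simp only [nbrSum, Finset.mul_sum]
  rw [Finset.sum_comm]
  refine Finset.sum_congr rfl fun i _ => Finset.sum_congr rfl fun j _ => ?_
  by_cases h : G.Adj i j
  · simp [h, h.symm, mul_comm]
  · have h' : ¬ G.Adj j i := fun h' => h h'.symm
    simp [h, h']

theorem nbrSum_add (G : SimpleGraph V) (v w : V → ℝ) (i : V) :
    nbrSum G (fun j => v j + w j) i = nbrSum G v i + nbrSum G w i := by
  simp only [nbrSum, ← Finset.sum_add_distrib]
  refine Finset.sum_congr rfl fun j _ => ?_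
  split_ifs <;> simp

theorem nbrSum_smul (G : SimpleGraph V) (t : ℝ) (v : V → ℝ) (i : V) :
    nbrSum G (fun j => t * v j) i = t * nbrSum G v i := by
  simp only [nbrSum, Finset.mul_sum]
  refine Finset.sum_congr rfl fun j _ => ?_
  split_ifs <;> simp

theorem hasEigenvalue_adjMatrix_iff (G : SimpleGraph V) [DecidableEq V] [DecidableRel G.Adj]
    (c : ℝ) :
    Module.End.HasEigenvalue (G.adjMatrix ℝ).mulVecLin c ↔
      ∃ v : V → ℝ, v ≠ 0 ∧ ∀ i, nbrSum G v i = c * v i := by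
  have key : ∀ (v : V → ℝ) (i : V), (G.adjMatrix ℝ).mulVecLin v i = nbrSum G v i := by
    intro v i
    simp only [Matrix.mulVecLin_apply, Matrix.mulVec, dotProduct, SimpleGraph.adjMatrix_apply,
      nbrSum, ite_mul, one_mul, zero_mul]
    exact Finset.sum_congr rfl fun j _ => by split_ifs <;> rfl
  constructor
  · intro h
    obtain ⟨v, hv⟩ := h.exists_hasEigenvector
    refine ⟨v, hv.2, fun i => ?_⟩
    rw [← key, hv.apply_eq_smul]; simp
  · rintro ⟨v, hv, h⟩
    refine Module.End.hasEigenvalue_of_hasEigenvector (x := v) ⟨?_, hv⟩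
    rw [Module.End.mem_eigenspace_iff]
    ext i
    rw [key, h]; simp

/-- The form attains a maximum `c` on the unit sphere. Replacing a maximiser by its absolute values
does not decrease the form, and the first-order condition at a maximiser is the eigenvalue equation.
-/
theorem exists_adjForm_max [Nonempty V] (G : SimpleGraph V) :
    ∃ (c : ℝ) (x : V → ℝ), (∀ i, 0 ≤ x i) ∧ x ≠ 0 ∧ (∀ i, nbrSum G x i = c * x i) ∧
      ∀ y : V → ℝ, ∑ i, y i * nbrSum G y i ≤ c * ∑ i, y i ^ 2 := by
  classical
  let K : Set (V → ℝ) := {y | ∑ i, y i ^ 2 = 1}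
  have hq : Continuous fun y : V → ℝ => ∑ i, y i * nbrSum G y i := by
    refine continuous_finsetSum _ fun i _ => (continuous_apply i).mul ?_
    refine continuous_finsetSum _ fun j _ => ?_
    split_ifs
    · exact continuous_apply j
    · exact continuous_const
  have hK : IsCompact K := by
    refine Metric.isCompact_of_isClosed_isBounded
      (isClosed_eq (by fun_prop) continuous_const) ?_
    refine (Metric.isBounded_closedBall (x := (0 : V → ℝ)) (r := 1)).subset fun y hy => ?_
    rw [mem_closedBall_zero_iff, pi_norm_le_iff_of_nonneg zero_le_one]
    intro i
    have h1 : y i ^ 2 ≤ ∑ i, y i ^ 2 :=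
      Finset.single_le_sum (f := fun i => y i ^ 2) (fun j _ => sq_nonneg _) (Finset.mem_univ i)
    rw [show ∑ i, y i ^ 2 = 1 from hy] at h1
    exact abs_le_one_iff_mul_self_le_one.2 (by nlinarith)
  have hne : K.Nonempty := by
    obtain ⟨a⟩ := ‹Nonempty V›
    refine ⟨Pi.single a 1, ?_⟩
    show ∑ i, (Pi.single a 1 : V → ℝ) i ^ 2 = 1
    rw [Finset.sum_eq_single a] <;> simp +contextual
  obtain ⟨y, hy, hmax⟩ := hK.exists_isMaxOn hne hq.continuousOn
  set c := ∑ i, y i * nbrSum G y i with hc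
  have hle : ∀ z : V → ℝ, ∑ i, z i * nbrSum G z i ≤ c * ∑ i, z i ^ 2 := by
    intro z
    rcases (Finset.sum_nonneg fun i _ => sq_nonneg (z i) :
      (0 : ℝ) ≤ ∑ i, z i ^ 2).eq_or_lt with h0 | hpos
    · have hz : ∀ i, z i = 0 := by
        intro i
        have := (Finset.sum_eq_zero_iff_of_nonneg (fun i _ => sq_nonneg (z i))).1 h0.symm i
          (Finset.mem_univ i)
        exact pow_eq_zero_iff two_ne_zero |>.1 this
      simp [hz]
    · set s := ∑ i, z i ^ 2 with hs
      have hr : 0 < Real.sqrt s := Real.sqrt_pos.2 hpos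
      have hmem : (fun i => (Real.sqrt s)⁻¹ * z i) ∈ K := by
        show ∑ i, ((Real.sqrt s)⁻¹ * z i) ^ 2 = 1
        simp only [mul_pow, ← Finset.mul_sum]
        rw [inv_pow, Real.sq_sqrt hpos.le, ← hs, inv_mul_cancel₀ hpos.ne']
      have h := hmax hmem
      simp only [Set.mem_ofPred_eq, nbrSum_smul] at h
      have h2 : ∑ i, (Real.sqrt s)⁻¹ * z i * ((Real.sqrt s)⁻¹ * nbrSum G z i)
          = s⁻¹ * ∑ i, z i * nbrSum G z i := by
        rw [Finset.mul_sum]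
        refine Finset.sum_congr rfl fun i _ => ?_
        have : (Real.sqrt s)⁻¹ * (Real.sqrt s)⁻¹ = s⁻¹ := by
          rw [← mul_inv, Real.mul_self_sqrt hpos.le]
        rw [← this]; ring
      rw [h2, ← hc, inv_mul_le_iff₀ hpos] at h
      linarith
  have hx1 : ∑ i, |y i| ^ 2 = 1 := by
    simp only [sq_abs]
    exact hy
  have hx2 : c ≤ ∑ i, |y i| * nbrSum G (fun j => |y j|) i := by
    rw [hc]
    refine Finset.sum_le_sum fun i _ => ?_
    simp only [nbrSum, Finset.mul_sum]
    refine Finset.sum_le_sum fun j _ => ?_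
    split_ifs
    · rw [← abs_mul]; exact le_abs_self _
    · simp
  refine ⟨c, fun i => |y i|, fun i => abs_nonneg _, ?_, ?_, hle⟩
  · intro h
    have : ∀ i, |y i| = 0 := fun i => congrFun h i
    simp [this] at hx1
  · set x : V → ℝ := fun i => |y i| with hx
    have lin : ∀ (z : V → ℝ) (t : ℝ),
        0 ≤ 2 * t * (∑ i, z i * (c * x i - nbrSum G x i)) +
          t ^ 2 * (c * (∑ i, z i ^ 2) - ∑ i, z i * nbrSum G z i) := by
      intro z t
      have h := hle fun i => x i + t * z i
      have e1 : ∑ i, (x i + t * z i) * nbrSum G (fun i => x i + t * z i) i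
          = ∑ i, x i * nbrSum G x i + 2 * t * ∑ i, z i * nbrSum G x i
            + t ^ 2 * ∑ i, z i * nbrSum G z i := by
        have : ∑ i, x i * nbrSum G z i = ∑ i, z i * nbrSum G x i := adjForm_comm G x z
        calc _ = ∑ i, (x i * nbrSum G x i + t * (x i * nbrSum G z i)
              + t * (z i * nbrSum G x i) + t ^ 2 * (z i * nbrSum G z i)) := by
              refine Finset.sum_congr rfl fun i _ => ?_
              rw [nbrSum_add G x (fun j => t * z j), nbrSum_smul]; ring
          _ = _ := by
              simp only [Finset.sum_add_distrib, ← Finset.mul_sum]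
              rw [this]; ring
      have e2 : ∑ i, (x i + t * z i) ^ 2
          = ∑ i, x i ^ 2 + 2 * t * ∑ i, z i * x i + t ^ 2 * ∑ i, z i ^ 2 := by
        simp only [Finset.mul_sum, ← Finset.sum_add_distrib]
        exact Finset.sum_congr rfl fun i _ => by ring
      have e3 : ∑ i, z i * (c * x i - nbrSum G x i)
          = c * ∑ i, z i * x i - ∑ i, z i * nbrSum G x i := by
        rw [Finset.mul_sum, ← Finset.sum_sub_distrib]
        exact Finset.sum_congr rfl fun i _ => by ring
      rw [e1, e2] at h
      rw [e3]
      have hx1' : ∑ i, x i ^ 2 = 1 := hx1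
      rw [hx1'] at h
      have hx2' : c ≤ ∑ i, x i * nbrSum G x i := hx2
      linarith
    set z : V → ℝ := fun i => c * x i - nbrSum G x i with hz
    have hzz : ∑ i, z i * z i = 0 := by
      set A := ∑ i, z i * z i with hA
      set B := c * (∑ i, z i ^ 2) - ∑ i, z i * nbrSum G z i with hB
      have hA0 : 0 ≤ A := Finset.sum_nonneg fun i _ => mul_self_nonneg _
      have hB0 : 0 ≤ B := by linarith [hle z]
      by_contra hne
      have hApos : 0 < A := lt_of_le_of_ne hA0 (Ne.symm hne)
      -- A negative `t` close to the minimiser of `2 t A + t² B`; the `+ 1` allows `B = 0`.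
      have h := lin z (-(A / (B + 1)))
      have hB1 : 0 < B + 1 := by linarith
      have hu : 0 < A / (B + 1) := div_pos hApos hB1
      have hAe : A = A / (B + 1) * (B + 1) := by field_simp
      set w := A / (B + 1)
      have : 2 * -w * A + (-w) ^ 2 * B = - w ^ 2 * (B + 2) := by rw [hAe]; ring
      rw [← hA] at h
      nlinarith [mul_pos (pow_pos hu 2) hB1]
    intro i
    have := (Finset.sum_eq_zero_iff_of_nonneg (fun i _ => mul_self_nonneg (z i))).1 hzz i
      (Finset.mem_univ i)
    have h0 : z i = 0 := mul_self_eq_zero.1 this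
    simp only [hz] at h0
    linarith

theorem le_of_adjForm_le {G : SimpleGraph V} {c d : ℝ} {v : V → ℝ} (hv : v ≠ 0)
    (h : ∀ i, nbrSum G v i = d * v i)
    (hle : ∑ i, v i * nbrSum G v i ≤ c * ∑ i, v i ^ 2) : d ≤ c := by
  have e : ∑ i, v i * nbrSum G v i = d * ∑ i, v i ^ 2 := by
    rw [Finset.mul_sum]
    exact Finset.sum_congr rfl fun i _ => by rw [h]; ring
  obtain ⟨a, ha⟩ := Function.ne_iff.1 hv
  have hpos : 0 < ∑ i, v i ^ 2 :=
    Finset.sum_pos' (fun i _ => sq_nonneg _) ⟨a, Finset.mem_univ a, by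
      have : v a ≠ 0 := ha
      positivity⟩
  rw [e] at hle
  exact le_of_mul_le_mul_right hle hpos

theorem isGreatest_graphMu [Nonempty V] (G : SimpleGraph V) :
    (∃ x : V → ℝ, (∀ i, 0 ≤ x i) ∧ x ≠ 0 ∧ ∀ i, nbrSum G x i = graphMu G * x i) ∧
      ∀ y : V → ℝ, ∑ i, y i * nbrSum G y i ≤ graphMu G * ∑ i, y i ^ 2 := by
  classical
  obtain ⟨c, x, h0, hx, he, hle⟩ := exists_adjForm_max G
  have : graphMu G = c := by
    refine IsGreatest.csSup_eq ⟨?_, ?_⟩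
    · exact (hasEigenvalue_adjMatrix_iff G c).2 ⟨x, hx, he⟩
    · intro d hd
      obtain ⟨v, hv, h⟩ := (hasEigenvalue_adjMatrix_iff G d).1 hd
      exact le_of_adjForm_le hv h (hle v)
  rw [this]
  exact ⟨⟨x, h0, hx, he⟩, hle⟩

theorem exists_perron_vector [Nonempty V] (G : SimpleGraph V) :
    ∃ x : V → ℝ, (∀ i, 0 ≤ x i) ∧ x ≠ 0 ∧ ∀ i, nbrSum G x i = graphMu G * x i :=
  (isGreatest_graphMu G).1

theorem adjForm_le_graphMu (G : SimpleGraph V) (y : V → ℝ) :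
    ∑ i, y i * nbrSum G y i ≤ graphMu G * ∑ i, y i ^ 2 := by
  cases isEmpty_or_nonempty V
  · simp
  · exact (isGreatest_graphMu G).2 y

theorem le_graphMu {G : SimpleGraph V} {c : ℝ} {v : V → ℝ} (hv : v ≠ 0)
    (h : ∀ i, nbrSum G v i = c * v i) : c ≤ graphMu G :=
  le_of_adjForm_le hv h (adjForm_le_graphMu G v)

theorem graphMu_congr {W : Type*} [Fintype W] {G : SimpleGraph V} {H : SimpleGraph W}
    (e : G ≃g H) : graphMu G = graphMu H := by
  classical
  have key : ∀ (v : W → ℝ) (i : V), nbrSum G (fun j => v (e j)) i = nbrSum H v (e i) := by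
    intro v i
    simp only [nbrSum]
    refine Fintype.sum_equiv e.toEquiv _ _ fun j => ?_
    simp [e.map_adj_iff]
  unfold graphMu
  congr 1
  ext c
  simp only [Set.mem_ofPred_eq, hasEigenvalue_adjMatrix_iff]
  constructor
  · rintro ⟨v, hv, h⟩
    refine ⟨fun j => v (e.symm j), fun h0 => hv ?_, fun i => ?_⟩
    · ext i; simpa using congrFun h0 (e i)
    · obtain ⟨i, rfl⟩ := e.surjective i
      rw [← key]; simpa using h i
  · rintro ⟨v, hv, h⟩
    refine ⟨fun j => v (e j), fun h0 => hv ?_, fun i => ?_⟩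
    · ext i; simpa using congrFun h0 (e.symm i)
    · rw [key, h]

/-- Comparison with a graph that has a dominating vertex. -/
theorem eq_of_support_le {G K : SimpleGraph V} {l : V} (hl : ∀ j, j ≠ l → K.Adj l j)
    {c : ℝ} (hc : graphMu K ≤ c) {x : V → ℝ} (h0 : ∀ i, 0 ≤ x i) (hx : x ≠ 0)
    (he : ∀ i, nbrSum G x i = c * x i)
    (hsub : ∀ i j, 0 < x i → 0 < x j → G.Adj i j → K.Adj i j) : G = K := by
  classical
  have term : ∀ i j, x i * (if G.Adj i j then x j else 0) ≤ x i * (if K.Adj i j then x j else 0) := by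
    intro i j
    rcases (h0 i).eq_or_lt with hi | hi
    · simp [← hi]
    rcases (h0 j).eq_or_lt with hj | hj
    · simp [← hj]
    by_cases hg : G.Adj i j
    · simp [hg, hsub i j hi hj hg]
    · simp only [hg, if_false, mul_zero]
      split_ifs <;> positivity
  have row : ∀ i, x i * nbrSum G x i ≤ x i * nbrSum K x i := by
    intro i
    simp only [nbrSum, Finset.mul_sum]
    exact Finset.sum_le_sum fun j _ => term i j
  have hsum : ∑ i, x i * nbrSum G x i = c * ∑ i, x i ^ 2 := by
    rw [Finset.mul_sum]
    exact Finset.sum_congr rfl fun i _ => by rw [he]; ring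
  have hs0 : 0 ≤ ∑ i, x i ^ 2 := Finset.sum_nonneg fun i _ => sq_nonneg _
  have hK := adjForm_le_graphMu K x
  have hGK : ∑ i, x i * nbrSum G x i = ∑ i, x i * nbrSum K x i := by
    refine le_antisymm (Finset.sum_le_sum fun i _ => row i) ?_
    rw [hsum]
    exact hK.trans (mul_le_mul_of_nonneg_right hc hs0)
  have hrow : ∀ i, x i * nbrSum G x i = x i * nbrSum K x i := fun i =>
    (Finset.sum_eq_sum_iff_of_le fun i _ => row i).1 hGK i (Finset.mem_univ i)
  have hterm : ∀ i j, x i * (if G.Adj i j then x j else 0)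
      = x i * (if K.Adj i j then x j else 0) := by
    intro i j
    have := hrow i
    simp only [nbrSum, Finset.mul_sum] at this
    exact (Finset.sum_eq_sum_iff_of_le fun j _ => term i j).1 this j (Finset.mem_univ j)
  -- the vector is an eigenvector of `K`, by maximality of its Rayleigh quotient
  have hKle : ∀ i, c * x i ≤ nbrSum K x i := by
    intro i
    rcases (h0 i).eq_or_lt with hi | hi
    · rw [← hi, mul_zero]
      exact Finset.sum_nonneg fun j _ => by split_ifs <;> simp [h0]
    · have := hrow i
      rw [he] at this
      exact (mul_left_cancel₀ hi.ne' this).le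
  have hmax : c * ∑ i, x i ^ 2 = ∑ i, x i * nbrSum K x i := by rw [← hsum, hGK]
  have hcK : c = graphMu K := by
    refine le_antisymm ?_ hc
    obtain ⟨a, ha⟩ := Function.ne_iff.1 hx
    have hpos : 0 < ∑ i, x i ^ 2 :=
      Finset.sum_pos' (fun i _ => sq_nonneg _) ⟨a, Finset.mem_univ a, by
        have : x a ≠ 0 := ha
        positivity⟩
    refine le_of_mul_le_mul_right ?_ hpos
    rw [hmax]; exact hK
  -- If the defect `z` were nonzero, moving from `x` towards `z` would raise the Rayleigh quotient
  -- of `K` above its maximum `c`.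
  have heK : ∀ i, nbrSum K x i = c * x i := by
    set z : V → ℝ := fun i => nbrSum K x i - c * x i with hz
    have hz0 : ∀ i, 0 ≤ z i := fun i => sub_nonneg.2 (hKle i)
    have hzn : ∀ i, 0 ≤ nbrSum K z i := fun i =>
      Finset.sum_nonneg fun j _ => by split_ifs <;> simp [hz0]
    by_contra hne
    push Not at hne
    obtain ⟨a, ha⟩ := hne
    have hza : 0 < z a := lt_of_le_of_ne (hz0 a) (by
      intro h; apply ha; simp only [hz] at h; linarith)
    have hA : 0 < ∑ i, z i ^ 2 :=
      Finset.sum_pos' (fun i _ => sq_nonneg _) ⟨a, Finset.mem_univ a, by positivity⟩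
    set A := ∑ i, z i ^ 2 with hAdef
    have hB : 0 ≤ ∑ i, z i * nbrSum K z i :=
      Finset.sum_nonneg fun i _ => mul_nonneg (hz0 i) (hzn i)
    -- Small enough that `c * t ≤ 1`, so the second-order loss `c t² A` stays below the first-order
    -- gain `2 t A`.
    set t : ℝ := 1 / (|c| + 1) with ht
    have htpos : 0 < t := by positivity
    have h := adjForm_le_graphMu K fun i => x i + t * z i
    rw [← hcK] at h
    have e1 : ∑ i, (x i + t * z i) * nbrSum K (fun i => x i + t * z i) i
        = ∑ i, x i * nbrSum K x i + 2 * t * ∑ i, z i * nbrSum K x i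
          + t ^ 2 * ∑ i, z i * nbrSum K z i := by
      have : ∑ i, x i * nbrSum K z i = ∑ i, z i * nbrSum K x i := adjForm_comm K x z
      calc _ = ∑ i, (x i * nbrSum K x i + t * (x i * nbrSum K z i)
            + t * (z i * nbrSum K x i) + t ^ 2 * (z i * nbrSum K z i)) := by
            refine Finset.sum_congr rfl fun i _ => ?_
            rw [nbrSum_add K x (fun j => t * z j), nbrSum_smul]; ring
        _ = _ := by
            simp only [Finset.sum_add_distrib, ← Finset.mul_sum]
            rw [this]; ring
    have e2 : ∑ i, (x i + t * z i) ^ 2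
        = ∑ i, x i ^ 2 + 2 * t * ∑ i, z i * x i + t ^ 2 * A := by
      simp only [hAdef, Finset.mul_sum, ← Finset.sum_add_distrib]
      exact Finset.sum_congr rfl fun i _ => by ring
    have e3 : ∑ i, z i * nbrSum K x i = c * ∑ i, z i * x i + A := by
      rw [hAdef, Finset.mul_sum, ← Finset.sum_add_distrib]
      exact Finset.sum_congr rfl fun i _ => by simp only [hz]; ring
    rw [e1, e2, e3, ← hmax] at h
    have h2 : 2 * t * A ≤ c * t ^ 2 * A := by nlinarith [mul_nonneg (sq_nonneg t) hB]
    have h3 : c * t ≤ 1 := by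
      rw [ht, mul_one_div, div_le_one (by positivity)]
      linarith [le_abs_self c]
    have h4 : c * t ^ 2 * A ≤ t * A := by
      have : 0 < t * A := mul_pos htpos hA
      nlinarith
    nlinarith [mul_pos htpos hA]
  -- A zero of `x` spreads along the edges of `K`, hence through `l` to all vertices. So `x` is
  -- positive, and the termwise equality recovers every edge.
  have hzero : ∀ i, x i = 0 → ∀ j, K.Adj i j → x j = 0 := by
    intro i hi j hij
    have h := heK i
    rw [hi, mul_zero] at h
    have := (Finset.sum_eq_zero_iff_of_nonneg (fun j _ => by split_ifs <;> simp [h0])).1 h j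
      (Finset.mem_univ j)
    simpa [hij] using this
  have hpos : ∀ i, 0 < x i := by
    intro i
    refine lt_of_le_of_ne (h0 i) fun hi => hx ?_
    have hxl : x l = 0 := by
      by_cases hil : i = l
      · rw [← hil]; exact hi.symm
      · exact hzero i hi.symm l (hl i hil).symm
    ext j
    by_cases hj : j = l
    · rw [hj]; exact hxl
    · exact hzero l hxl j (hl j hj)
  ext i j
  have h := mul_left_cancel₀ (hpos i).ne' (hterm i j)
  by_cases h1 : G.Adj i j <;> by_cases h2 : K.Adj i j <;> simp [h1, h2] at h ⊢
  · exact (hpos j).ne' h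
  · exact (hpos j).ne h

/-- Restricting an eigenvector to a set that is closed under adjacency. -/
theorem nbrSum_indicator_of_closed {G : SimpleGraph V} {C : Set V}
    (hC : ∀ a ∈ C, ∀ b, G.Adj a b → b ∈ C) {c : ℝ} {x : V → ℝ}
    (he : ∀ i, nbrSum G x i = c * x i) (i : V) :
    nbrSum G (C.indicator x) i = c * C.indicator x i := by
  classical
  by_cases hi : i ∈ C
  · rw [Set.indicator_of_mem hi, ← he]
    refine Finset.sum_congr rfl fun j _ => ?_
    split_ifs with h
    · rw [Set.indicator_of_mem (hC i hi j h)]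
    · rfl
  · rw [Set.indicator_of_notMem hi, mul_zero]
    refine Finset.sum_eq_zero fun j _ => ?_
    split_ifs with h
    · exact Set.indicator_of_notMem (fun hj => hi (hC j hj i h.symm)) _
    · rfl

/-- Only edges inside a union of components that carries weight need to be compared, since the
eigenvector can be cut down to it. The conclusion still concerns all of `G`, because equality makes
the restricted vector positive everywhere. -/
theorem eq_of_closed_le {G K : SimpleGraph V} {l : V} (hl : ∀ j, j ≠ l → K.Adj l j)
    {c : ℝ} (hc : graphMu K ≤ c) {x : V → ℝ} (h0 : ∀ i, 0 ≤ x i)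
    (he : ∀ i, nbrSum G x i = c * x i) {C : Set V} (hC : ∀ a ∈ C, ∀ b, G.Adj a b → b ∈ C)
    {u : V} (hu : u ∈ C) (hxu : 0 < x u)
    (hsub : ∀ i ∈ C, ∀ j ∈ C, G.Adj i j → K.Adj i j) : G = K := by
  refine eq_of_support_le hl hc (x := C.indicator x)
    (fun i => Set.indicator_nonneg (fun i _ => h0 i) i) (fun h => ?_)
    (nbrSum_indicator_of_closed hC he) fun i j hi hj hij => ?_
  · have := congrFun h u
    rw [Set.indicator_of_mem hu] at this
    exact hxu.ne' this
  · refine hsub i ?_ j ?_ hij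
    · by_contra h; rw [Set.indicator_of_notMem h] at hi; exact hi.false
    · by_contra h; rw [Set.indicator_of_notMem h] at hj; exact hj.false

theorem exists_nonneg_of_weighted_sum_eq_zero {x g : V → ℝ} (h0 : ∀ i, 0 ≤ x i) (hx : x ≠ 0)
    (h : ∑ i, x i * g i = 0) : ∃ u, 0 < x u ∧ 0 ≤ g u := by
  by_contra! hcon
  obtain ⟨b, hb⟩ := Function.ne_iff.1 hx
  have hbpos : 0 < x b := lt_of_le_of_ne (h0 b) (Ne.symm hb)
  refine h.not_lt (Finset.sum_neg' (fun i _ => ?_)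
    ⟨b, Finset.mem_univ b, mul_neg_of_pos_of_neg hbpos (hcon b hbpos)⟩)
  rcases (h0 i).eq_or_lt with hi | hi
  · simp [← hi]
  · exact mul_nonpos_of_nonneg_of_nonpos hi.le (hcon i hi).le

theorem sum_mul_nbrSum_of_eigenvector {G : SimpleGraph V} {c : ℝ} {x : V → ℝ}
    (he : ∀ i, nbrSum G x i = c * x i) (v : V → ℝ) :
    ∑ i, x i * nbrSum G v i = c * ∑ i, x i * v i := by
  rw [adjForm_comm, Finset.mul_sum]
  exact Finset.sum_congr rfl fun i _ => by rw [he]; ring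

theorem exists_le_nbrSum_one {G : SimpleGraph V} {c : ℝ} {x : V → ℝ}
    (h0 : ∀ i, 0 ≤ x i) (hx : x ≠ 0) (he : ∀ i, nbrSum G x i = c * x i) :
    ∃ u, 0 < x u ∧ c ≤ nbrSum G (fun _ => 1) u := by
  obtain ⟨u, hu, h⟩ := exists_nonneg_of_weighted_sum_eq_zero h0 hx
    (g := fun i => nbrSum G (fun _ => 1) i - c * 1) (by
      simp only [mul_sub, Finset.sum_sub_distrib, sum_mul_nbrSum_of_eigenvector he,
        Finset.mul_sum]
      rw [sub_eq_zero]
      exact Finset.sum_congr rfl fun i _ => by ring)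
  exact ⟨u, hu, by linarith⟩

/-- By symmetry of the adjacency matrix, the `x`-weighted average of `A²1 - a A1` is exactly `c² - a
c`, so some vertex of positive weight reaches it. -/
theorem exists_le_nbrSum_nbrSum_one {G : SimpleGraph V} {c : ℝ} {x : V → ℝ}
    (h0 : ∀ i, 0 ≤ x i) (hx : x ≠ 0) (he : ∀ i, nbrSum G x i = c * x i) (a : ℝ) :
    ∃ u, 0 < x u ∧ c ^ 2 - a * c ≤
      nbrSum G (nbrSum G fun _ => 1) u - a * nbrSum G (fun _ => 1) u := by
  obtain ⟨u, hu, h⟩ := exists_nonneg_of_weighted_sum_eq_zero h0 hx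
    (g := fun i => nbrSum G (nbrSum G fun _ => 1) i - a * nbrSum G (fun _ => 1) i
      - (c ^ 2 - a * c)) (by
      have : ∀ i, x i * (nbrSum G (nbrSum G fun _ => 1) i - a * nbrSum G (fun _ => 1) i
          - (c ^ 2 - a * c)) = x i * nbrSum G (nbrSum G fun _ => 1) i
            - a * (x i * nbrSum G (fun _ => 1) i) - (c ^ 2 - a * c) * (x i * 1) := by
        intro i; ring
      simp only [this, Finset.sum_sub_distrib, ← Finset.mul_sum,
        sum_mul_nbrSum_of_eigenvector he]
      ring)
  exact ⟨u, hu, by linarith⟩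

end Spectral

/-! ### Paths as vertex lists, and detours from a longest path. -/

section Paths

/-- A list of distinct vertices, consecutive ones being adjacent. -/
def PathList {V : Type*} (G : SimpleGraph V) (l : List V) : Prop :=
  l.Nodup ∧ l.IsChain G.Adj

variable {V : Type*}

theorem PathList.containsPath {G : SimpleGraph V} {l : List V} (hl : PathList G l) {m : ℕ}
    (hm : m ≤ l.length) : ContainsPath m G := by
  refine ⟨⟨⟨fun i => l[i.val]'(i.isLt.trans_le hm), ?_⟩, ?_⟩⟩
  · intro i j hij
    rw [SimpleGraph.pathGraph_adj] at hij
    rcases hij with h | h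
    · have := hl.2.getElem i.val (by omega)
      simpa [h] using this
    · have := hl.2.getElem j.val (by omega)
      simpa [h] using this.symm
  · intro i j hij
    have := (hl.1.getElem_inj_iff).1 hij
    exact Fin.ext this

theorem ContainsPath.exists_pathList {G : SimpleGraph V} {m : ℕ} (h : ContainsPath m G) :
    ∃ l : List V, PathList G l ∧ l.length = m := by
  obtain ⟨f⟩ := h
  refine ⟨List.ofFn f, ⟨List.nodup_ofFn.2 f.injective, ?_⟩, List.length_ofFn⟩
  rw [List.isChain_iff_getElem]
  intro i hi
  simp only [List.getElem_ofFn]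
  rw [List.length_ofFn] at hi
  exact f.toHom.map_adj (SimpleGraph.pathGraph_adj.2 (Or.inl rfl))

theorem PathList.reverse {G : SimpleGraph V} {l : List V} (hl : PathList G l) :
    PathList G l.reverse := by
  refine ⟨List.nodup_reverse.2 hl.1, ?_⟩
  rw [List.isChain_reverse]
  exact hl.2.imp fun a b h => h.symm

theorem PathList.append {G : SimpleGraph V} {l m : List V} (hl : PathList G l)
    (hm : PathList G m) (hd : ∀ v ∈ l, v ∉ m)
    (h : ∀ a ∈ l.getLast?, ∀ b ∈ m.head?, G.Adj a b) : PathList G (l ++ m) :=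
  ⟨List.nodup_append'.2 ⟨hl.1, hm.1, fun _ h1 h2 => hd _ h1 h2⟩, hl.2.append hm.2 h⟩

theorem PathList.take {G : SimpleGraph V} {l : List V} (hl : PathList G l) (i : ℕ) :
    PathList G (l.take i) :=
  ⟨hl.1.sublist (List.take_sublist _ _), hl.2.take i⟩

theorem PathList.drop {G : SimpleGraph V} {l : List V} (hl : PathList G l) (i : ℕ) :
    PathList G (l.drop i) :=
  ⟨hl.1.sublist (List.drop_sublist _ _), hl.2.drop i⟩

theorem PathList.mono {G H : SimpleGraph V} (h : ∀ a b, H.Adj a b → G.Adj a b) {l : List V}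
    (hl : PathList H l) : PathList G l :=
  ⟨hl.1, hl.2.imp fun a b => h a b⟩

theorem exists_longest_list [Fintype V] {Q : List V → Prop} (hQ : ∀ l, Q l → l.Nodup)
    (hne : ∃ l, Q l) : ∃ l, Q l ∧ ∀ l', Q l' → l'.length ≤ l.length := by
  classical
  obtain ⟨l0, hl0⟩ := hne
  let p : ℕ → Prop := fun m => ∃ l, Q l ∧ l.length = m
  have hb : ∀ l, Q l → l.length ≤ Fintype.card V := fun l hl => (hQ l hl).length_le_card
  obtain ⟨l, hl, hlen⟩ : p (Nat.findGreatest p (Fintype.card V)) :=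
    Nat.findGreatest_spec (hb l0 hl0) ⟨l0, hl0, rfl⟩
  exact ⟨l, hl, fun l' hl' => hlen ▸ Nat.le_findGreatest (hb l' hl') ⟨l', hl', rfl⟩⟩

section Longest

variable {H : SimpleGraph V} {P τ : List V}

/-- Replacing either end segment of `P` at the attachment point by `τ` gives a path, which cannot be
longer than `P`. -/
theorem attach_bounds (hP : PathList H P) (hmax : ∀ l, PathList H l → l.length ≤ P.length)
    (hτ : PathList H τ) (hd : ∀ v ∈ τ, v ∉ P) {a : V} (ha : a ∈ τ.head?) {y : ℕ}
    (hy : y < P.length) (hay : H.Adj a P[y]) :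
    τ.length ≤ y ∧ y + 1 + τ.length ≤ P.length := by
  constructor
  · have h := hmax _ (hτ.reverse.append (hP.drop y)
      (fun v hv hv' => hd v (List.mem_reverse.1 hv) (List.mem_of_mem_drop hv'))
      (by
        intro b hb c hc
        rw [List.getLast?_reverse] at hb
        rw [List.head?_drop, List.getElem?_eq_getElem hy] at hc
        simp only [Option.mem_def] at ha hb hc
        rw [ha] at hb
        cases hb; cases hc; exact hay))
    simp only [List.length_append, List.length_reverse, List.length_drop] at h
    omega
  · have h := hmax _ ((hP.take (y + 1)).append hτ
      (fun v hv hv' => hd v hv' (List.mem_of_mem_take hv))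
      (by
        intro b hb c hc
        rw [List.getLast?_take] at hb
        simp only [Option.mem_def] at ha hb hc
        rw [ha] at hc
        simp [List.getElem?_eq_getElem hy] at hb
        cases hb; cases hc; exact hay.symm))
    simp only [List.length_append, List.length_take] at h
    omega

/-- Replacing the segment of `P` strictly between the two attachment points by `τ` gives a path, so
that segment has at least as many vertices as `τ`. -/
theorem attach_gap (hP : PathList H P) (hmax : ∀ l, PathList H l → l.length ≤ P.length)
    (hτ : PathList H τ) (hd : ∀ v ∈ τ, v ∉ P) {a b : V} (ha : a ∈ τ.head?)
    (hb : b ∈ τ.getLast?) {x y : ℕ} (hxy : x < y) (hy : y < P.length)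
    (hax : H.Adj a (P[x]'(hxy.trans hy))) (hby : H.Adj b P[y]) :
    x + 1 + τ.length ≤ y := by
  have hx := hxy.trans hy
  have hne : τ ≠ [] := by rintro rfl; simp at ha
  have h1 : PathList H (P.take (x + 1) ++ τ) := (hP.take (x + 1)).append hτ
      (fun v hv hv' => hd v hv' (List.mem_of_mem_take hv))
      (by
        intro c hc e he
        rw [List.getLast?_take] at hc
        simp only [Option.mem_def] at ha hc he
        rw [ha] at he
        simp [List.getElem?_eq_getElem hx] at hc
        cases hc; cases he; exact hax.symm)
  have h := hmax _ (h1.append (hP.drop y)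
    (by
      intro v hv hv'
      rcases List.mem_append.1 hv with hv | hv
      · have hdis : List.Disjoint (P.take (x + 1)) (P.drop y) :=
          List.disjoint_take_drop hP.1 (by omega)
        exact hdis hv hv'
      · exact hd v hv (List.mem_of_mem_drop hv'))
    (by
      intro c hc e he
      rw [List.getLast?_append_of_ne_nil _ hne] at hc
      rw [List.head?_drop, List.getElem?_eq_getElem hy] at he
      simp only [Option.mem_def] at hb hc he
      rw [hb] at hc
      cases hc; cases he; exact hby))
  simp only [List.length_append, List.length_take, List.length_drop] at h
  omega

end Longest

theorem card_le_of_gaps {S : Finset ℕ} {a b : ℕ} (h : ∀ x ∈ S, a ≤ x ∧ x < b)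
    (hg : ∀ x ∈ S, ∀ y ∈ S, x < y → x + 2 ≤ y) : S.card ≤ (b - a + 1) / 2 := by
  rw [← Finset.card_range ((b - a + 1) / 2)]
  refine Finset.card_le_card_of_injOn (fun x => (x - a) / 2) (fun x hx => ?_) ?_
  · have := h x hx
    simp only [Finset.coe_range, Set.mem_Iio]
    omega
  · intro x hx y hy hxy
    have h1 := h x hx
    have h2 := h y hy
    have h3 := hg x hx y hy
    have h4 := hg y hy x hx
    simp only at hxy
    omega

/-- Here `S` collects the positions on a longest path where one end of a detour of `j` vertices
attaches, and `y` is an attachment of the other end. The margins of width `j` at both ends of the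
path and on both sides of `y` cost enough positions to save `j`. -/
theorem card_le_of_attach {S : Finset ℕ} {j k p y : ℕ} (hj : 2 ≤ j) (hp : p ≤ 2 * k + 2)
    (hS : ∀ x ∈ S, j ≤ x ∧ x + 1 + j ≤ p) (hg : ∀ x ∈ S, ∀ y ∈ S, x < y → x + 2 ≤ y)
    (hy : j ≤ y ∧ y + 1 + j ≤ p) (hlt : ∀ x ∈ S, x < y → x + 1 + j ≤ y)
    (hgt : ∀ x ∈ S, y < x → y + 1 + j ≤ x) : S.card + j ≤ k + 1 := by
  classical
  have hsub : S ⊆ (S.filter (· < y)) ∪ ({y} ∪ S.filter (y < ·)) := by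
    intro x hx
    simp only [Finset.mem_union, Finset.mem_filter, Finset.mem_singleton]
    rcases lt_trichotomy x y with h | h | h <;> simp [h, hx]
  have h1 : (S.filter (· < y)).card ≤ ((y - j) - j + 1) / 2 := by
    refine card_le_of_gaps (fun x hx => ?_) fun x hx z hz => hg x (Finset.mem_filter.1 hx).1 z
      (Finset.mem_filter.1 hz).1
    rw [Finset.mem_filter] at hx
    have := hS x hx.1
    have := hlt x hx.1 hx.2
    omega
  have h2 : (S.filter (y < ·)).card ≤ ((p - j) - (y + 1 + j) + 1) / 2 := by
    refine card_le_of_gaps (fun x hx => ?_) fun x hx z hz => hg x (Finset.mem_filter.1 hx).1 z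
      (Finset.mem_filter.1 hz).1
    rw [Finset.mem_filter] at hx
    have := hS x hx.1
    have := hgt x hx.1 hx.2
    omega
  have h3 := (Finset.card_le_card hsub).trans ((Finset.card_union_le _ _).trans
    (Nat.add_le_add_left (Finset.card_union_le _ _) _))
  rw [Finset.card_singleton] at h3
  omega

open Classical in
/-- The positions in the list `l` of the neighbours of `a`. -/
noncomputable def nbrPos (H : SimpleGraph V) (a : V) (l : List V) : Finset ℕ :=
  (Finset.range l.length).filter fun i => ∃ h : i < l.length, H.Adj a l[i]

theorem mem_nbrPos {H : SimpleGraph V} {a : V} {l : List V} {i : ℕ} :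
    i ∈ nbrPos H a l ↔ ∃ h : i < l.length, H.Adj a l[i] := by
  simp only [nbrPos, Finset.mem_filter, Finset.mem_range]
  exact ⟨fun h => h.2, fun h => ⟨h.1, h⟩⟩

open Classical in
theorem card_nbrs_le_nbrPos [Fintype V] (H : SimpleGraph V) (a : V) (l : List V) :
    (Finset.univ.filter fun v => H.Adj a v ∧ v ∈ l).card ≤ (nbrPos H a l).card := by
  rcases l.eq_nil_or_concat with rfl | ⟨m, b, hm⟩
  · simp
  refine Finset.card_le_card_of_surjOn (fun i => l.getD i b) ?_
  intro v hv
  simp only [Finset.coe_filter, Finset.mem_univ, true_and, Set.mem_ofPred_eq] at hv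
  obtain ⟨i, hi, rfl⟩ := List.getElem_of_mem hv.2
  exact ⟨i, mem_nbrPos.2 ⟨hi, hv.1⟩, by simp [hi]⟩

/-- The number of neighbours of a vertex. -/
noncomputable def deg [Fintype V] (H : SimpleGraph V) (a : V) : ℕ :=
  open Classical in (Finset.univ.filter fun v => H.Adj a v).card

theorem deg_le_nbrPos_add [Fintype V] {H : SimpleGraph V} {a : V} {l m : List V}
    (h : ∀ v, H.Adj a v → v ∈ l ∨ v ∈ m) :
    deg H a ≤ (nbrPos H a l).card + (nbrPos H a m).card := by
  classical
  refine le_trans (le_trans (Finset.card_le_card ?_) (Finset.card_union_le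
    (Finset.univ.filter fun v => H.Adj a v ∧ v ∈ l) (Finset.univ.filter fun v => H.Adj a v ∧ v ∈ m)))
    (Nat.add_le_add (card_nbrs_le_nbrPos H a l) (card_nbrs_le_nbrPos H a m))
  intro v hv
  simp only [Finset.mem_union, Finset.mem_filter, Finset.mem_univ, true_and] at hv ⊢
  rcases h v hv with h | h <;> simp [hv, h]

end Paths

/-! ### Vertices off a longest path. -/

section LongestPath

variable {V : Type*} {H : SimpleGraph V} {P τ : List V} {k : ℕ}

/-- `τ` is a longest path of `H` among those that avoid `P`. -/
def LongestOff (H : SimpleGraph V) (P τ : List V) : Prop :=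
  (PathList H τ ∧ ∀ v ∈ τ, v ∉ P) ∧
    ∀ σ, PathList H σ ∧ (∀ v ∈ σ, v ∉ P) → σ.length ≤ τ.length

theorem LongestOff.reverse (h : LongestOff H P τ) : LongestOff H P τ.reverse := by
  refine ⟨⟨h.1.1.reverse, fun v hv => h.1.2 v (List.mem_reverse.1 hv)⟩, fun σ hσ => ?_⟩
  rw [List.length_reverse]
  exact h.2 σ hσ

theorem LongestOff.mem_or_mem (h : LongestOff H P τ) {a : V} (ha : a ∈ τ.head?) {v : V}
    (hv : H.Adj a v) : v ∈ τ ∨ v ∈ P := by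
  by_contra! hcon
  have hp : PathList H ([v] ++ τ) := by
    refine PathList.append ⟨List.nodup_singleton v, List.isChain_singleton v⟩ h.1.1 ?_ ?_
    · simpa using hcon.1
    · intro b hb c hc
      simp only [List.getLast?_singleton, Option.mem_def, Option.some.injEq] at hb ha hc
      rw [ha] at hc
      cases hc; rw [← hb]; exact hv.symm
  have := h.2 _ ⟨hp, fun w hw => by
    rcases List.mem_append.1 hw with hw | hw
    · rw [List.mem_singleton.1 hw]; exact hcon.2
    · exact h.1.2 w hw⟩
  simp at this

theorem nbrPos_head_subset {a : V} (ha : a ∈ τ.head?) :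
    nbrPos H a τ ⊆ Finset.Ico 1 τ.length := by
  intro i hi
  obtain ⟨h, hadj⟩ := mem_nbrPos.1 hi
  rw [Finset.mem_Ico]
  refine ⟨?_, h⟩
  rcases Nat.eq_zero_or_pos i with rfl | h0
  · rw [Option.mem_def, List.head?_eq_getElem?, List.getElem?_eq_getElem h] at ha
    cases ha
    exact absurd hadj (H.loopless.irrefl _)
  · exact h0

variable [Fintype V] (hP : PathList H P) (hmax : ∀ l, PathList H l → l.length ≤ P.length)
  (hlen : P.length ≤ 2 * k + 2) {u : V} (huP : u ∈ P)
  (htouch : ∀ a b, H.Adj a b → H.Adj u a ∨ H.Adj u b)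
  (hdeg : ∀ a b, H.Adj a b → a ≠ u → k ≤ deg H a)
include hP hmax hlen huP htouch hdeg

/-- If the head `a` had no neighbour on `P`, its `k` or more neighbours would lie on `τ`, one of
them at position at least `k`. As `u` is on `P`, it is not adjacent to `a`, so it is adjacent to the
second vertex of `τ`. Rotating `τ` then yields a detour from `u` too long for `P`. -/
theorem LongestOff.nbrPos_nonempty (h : LongestOff H P τ) (hj : 2 ≤ τ.length) {a : V}
    (ha : a ∈ τ.head?) : (nbrPos H a P).Nonempty := by
  by_contra hne
  rw [Finset.not_nonempty_iff_eq_empty] at hne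
  match τ, h, hj, ha with
  | t :: s :: rest, h, hj, ha =>
    obtain rfl : t = a := by simpa using ha
    have hts : H.Adj t s := h.1.1.2.getElem 0 (by simp)
    have hd1 : k ≤ (nbrPos H t (t :: s :: rest)).card := by
      have := deg_le_nbrPos_add fun v hv => h.mem_or_mem ha (v := v) hv
      rw [hne, Finset.card_empty] at this
      exact (hdeg t s hts fun h1 => h.1.2 t List.mem_cons_self (h1 ▸ huP)).trans
        (by simpa using this)
    obtain ⟨z, hz, hzu⟩ := List.getElem_of_mem huP
    have hus : H.Adj u s := by
      rcases htouch t s hts with h1 | h1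
      · exfalso
        have : z ∈ nbrPos H t P := mem_nbrPos.2 ⟨hz, by rw [hzu]; exact h1.symm⟩
        rw [hne] at this
        simp at this
      · exact h1
    obtain ⟨i, hi, hki⟩ : ∃ i ∈ nbrPos H t (t :: s :: rest), k ≤ i := by
      by_contra! hcon
      have hsub : nbrPos H t (t :: s :: rest) ⊆ Finset.Ico 1 k := by
        intro i hi
        have := nbrPos_head_subset ha hi
        rw [Finset.mem_Ico] at this ⊢
        exact ⟨this.1, hcon i hi⟩
      have := Finset.card_le_card hsub
      rw [Nat.card_Ico] at this
      have hpos : 0 < k := by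
        by_contra h0
        have : k = 0 := by omega
        subst this
        have h1 : 1 ∈ nbrPos H t (t :: s :: rest) :=
          mem_nbrPos.2 ⟨by simp, by simpa using hts⟩
        exact absurd (hcon 1 h1) (by omega)
      omega
    obtain ⟨hil, hti⟩ := mem_nbrPos.1 hi
    have hi1 : 1 ≤ i := (Finset.mem_Ico.1 (nbrPos_head_subset ha hi)).1
    obtain ⟨i, rfl⟩ : ∃ i', i = i' + 1 := ⟨i - 1, by omega⟩
    simp only [List.length_cons] at hil
    have htail : PathList H (s :: rest) := by simpa using h.1.1.drop 1
    -- The rotation: start at `s`, follow `τ` to the far neighbour of `t`, and finish at `t`. It has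
    -- at least `k + 1` vertices, whereas `attach_bounds` would need `2 (k + 1) + 1 ≤ 2 k + 2`.
    have hp : PathList H ((s :: rest).take (i + 1) ++ [t]) := by
      refine (htail.take (i + 1)).append ⟨List.nodup_singleton t, List.isChain_singleton t⟩ ?_ ?_
      · intro v hv hv'
        rw [List.mem_singleton] at hv'
        subst hv'
        exact (List.nodup_cons.1 h.1.1.1).1 (List.mem_of_mem_take hv)
      · intro b hb c hc
        rw [List.getLast?_take] at hb
        have hil' : i < (s :: rest).length := by simp only [List.length_cons]; omega
        simp only [Option.mem_def, List.head?_cons, Option.some.injEq] at hb hc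
        simp only [Nat.add_eq_zero_iff, one_ne_zero, and_false, if_false, Nat.add_sub_cancel,
          List.getElem?_eq_getElem hil'] at hb
        rw [List.getElem_cons_succ] at hti
        subst hc
        have : (s :: rest)[i] = b := by simpa using hb
        rw [← this]
        exact hti.symm
    have hb := attach_bounds hP hmax hp
      (fun v hv => h.1.2 v (by
        rcases List.mem_append.1 hv with hv | hv
        · exact List.mem_cons_of_mem _ (List.mem_of_mem_take hv)
        · rw [List.mem_singleton.1 hv]; exact List.mem_cons_self))
      (a := s) (by simp) hz (by rw [hzu]; exact hus.symm)
    simp only [List.length_append, List.length_take, List.length_cons, List.length_nil] at hb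
    omega

/-- At most `k + 1 - |τ|` neighbours lie on `P` and at most `|τ| - 1` on `τ`, so the degree is at
most `k`. The lower bound `k` forces equality, whence `a` is adjacent to all other vertices of `τ`,
in particular to its last one. -/
theorem LongestOff.deg_le (h : LongestOff H P τ) (hj : 2 ≤ τ.length) {a b : V}
    (ha : a ∈ τ.head?) (hb : b ∈ τ.getLast?) : deg H a ≤ k ∧ H.Adj a b := by
  have hb' : b ∈ τ.reverse.head? := by rwa [List.head?_reverse]
  obtain ⟨y, hyb⟩ := h.reverse.nbrPos_nonempty hP hmax hlen huP htouch hdeg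
    (by rwa [List.length_reverse]) hb'
  obtain ⟨hyl, hby⟩ := mem_nbrPos.1 hyb
  have hy := attach_bounds hP hmax h.reverse.1.1 h.reverse.1.2 hb' hyl hby
  rw [List.length_reverse] at hy
  have hgapa : ∀ x ∈ nbrPos H a P, ∀ z ∈ nbrPos H a P, x < z → x + 2 ≤ z := by
    intro x hx z hz hxz
    obtain ⟨hxl, hax⟩ := mem_nbrPos.1 hx
    obtain ⟨hzl, haz⟩ := mem_nbrPos.1 hz
    have haP : a ∉ P := h.1.2 a (List.mem_of_mem_head? ha)
    have := attach_gap hP hmax (τ := [a]) ⟨List.nodup_singleton a, List.isChain_singleton a⟩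
      (by simpa using haP) (a := a) (b := a) (by simp) (by simp) hxz hzl hax haz
    rw [List.length_singleton] at this
    omega
  have hcard : (nbrPos H a P).card + τ.length ≤ k + 1 := by
    refine card_le_of_attach hj hlen (fun x hx => ?_) hgapa hy (fun x hx hxy => ?_)
      fun x hx hxy => ?_
    · obtain ⟨hxl, hax⟩ := mem_nbrPos.1 hx
      exact attach_bounds hP hmax h.1.1 h.1.2 ha hxl hax
    · obtain ⟨hxl, hax⟩ := mem_nbrPos.1 hx
      exact attach_gap hP hmax h.1.1 h.1.2 ha hb hxy hyl hax hby
    · obtain ⟨hxl, hax⟩ := mem_nbrPos.1 hx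
      have := attach_gap hP hmax h.reverse.1.1 h.reverse.1.2 hb'
        (by rwa [List.getLast?_reverse]) hxy hxl hby hax
      rwa [List.length_reverse] at this
  have hτ : (nbrPos H a τ).card ≤ τ.length - 1 := by
    have := Finset.card_le_card (nbrPos_head_subset (H := H) ha)
    rwa [Nat.card_Ico] at this
  have hd := deg_le_nbrPos_add fun v hv => h.mem_or_mem ha (v := v) hv
  refine ⟨by omega, ?_⟩
  -- `a` is adjacent to every other vertex of `τ`
  obtain ⟨s, has⟩ : ∃ s, H.Adj a s := by
    match τ, h, hj, ha with
    | t :: s :: rest, h, hj, ha =>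
      obtain rfl : t = a := by simpa using ha
      exact ⟨s, h.1.1.2.getElem 0 (by simp)⟩
  have hk := hdeg a s has fun h1 => h.1.2 a (List.mem_of_mem_head? ha) (h1 ▸ huP)
  have heq : nbrPos H a τ = Finset.Ico 1 τ.length :=
    Finset.eq_of_subset_of_card_le (nbrPos_head_subset ha) (by rw [Nat.card_Ico]; omega)
  have hlast : τ.length - 1 ∈ nbrPos H a τ := by
    rw [heq, Finset.mem_Ico]; omega
  obtain ⟨hl, hadj⟩ := mem_nbrPos.1 hlast
  rw [Option.mem_def, List.getLast?_eq_getElem?, List.getElem?_eq_getElem hl] at hb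
  cases hb
  exact hadj

omit huP in
-- If `u` is on `P`, a longest path off `P` with an edge would have adjacent ends, both of degree at
-- most `k`. If `u` is off `P`, it is adjacent to the second vertex of `P`, so all its neighbours
-- are on `P`, and every edge touches one of them.
theorem not_adj_off_longest
    (hpair : ∀ a b, H.Adj a b → a ≠ u → b ≠ u → ¬ (deg H a ≤ k ∧ deg H b ≤ k))
    {a b : V} (ha : a ∉ P) (hab : H.Adj a b) : b ∈ P := by
  by_contra hb
  by_cases huP : u ∈ P
  · have hpl : PathList H [a, b] ∧ ∀ v ∈ [a, b], v ∉ P := by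
      refine ⟨⟨by simp [hab.ne], List.isChain_pair.2 hab⟩, ?_⟩
      intro v hv
      simp only [List.mem_cons, List.not_mem_nil, or_false] at hv
      rcases hv with rfl | rfl <;> assumption
    obtain ⟨τ, h, hτmax⟩ := exists_longest_list
      (Q := fun σ => PathList H σ ∧ ∀ v ∈ σ, v ∉ P) (fun σ hσ => hσ.1.1) ⟨_, hpl⟩
    have hL : LongestOff H P τ := ⟨h, hτmax⟩
    have hj : 2 ≤ τ.length := hτmax _ hpl
    have hne : τ ≠ [] := by rintro rfl; simp at hj
    have hc : τ.head hne ∈ τ.head? := List.head_mem_head? hne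
    have he : τ.getLast hne ∈ τ.getLast? := List.getLast_mem_getLast? hne
    have h1 := hL.deg_le hP hmax hlen huP htouch hdeg hj hc he
    have h2 := hL.reverse.deg_le hP hmax hlen huP htouch hdeg (by rwa [List.length_reverse])
      (a := τ.getLast hne) (b := τ.head hne) (by rwa [List.head?_reverse])
      (by rwa [List.getLast?_reverse])
    refine hpair _ _ h1.2 ?_ ?_ ⟨h1.1, h2.1⟩
    · intro h3; exact h.2 _ (List.mem_of_mem_head? hc) (h3 ▸ huP)
    · intro h3; exact h.2 _ (List.mem_of_mem_getLast? he) (h3 ▸ huP)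
  · -- all neighbours of `u` lie on the path
    have hp2 : 2 ≤ P.length := hmax [a, b] ⟨by simp [hab.ne], List.isChain_pair.2 hab⟩
    have h01 : H.Adj P[0] P[1] := hP.2.getElem 0 (by omega)
    have huP1 : H.Adj u P[1] := by
      rcases htouch _ _ h01 with h | h
      · have := attach_bounds hP hmax (τ := [u])
          ⟨List.nodup_singleton u, List.isChain_singleton u⟩ (by simpa using huP)
          (a := u) (by simp) (y := 0) (by omega) h
        simp at this
      · exact h
    have hN : ∀ v, H.Adj u v → v ∈ P := by
      intro v hv
      by_contra hvP
      have := attach_bounds hP hmax (τ := [u, v])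
          ⟨by simp [hv.ne], List.isChain_pair.2 hv⟩ (by simp [huP, hvP])
          (a := u) (by simp) (y := 1) (by omega) huP1
      simp at this
    rcases htouch a b hab with h | h
    · exact ha (hN a h)
    · exact hb (hN b h)

omit [Fintype V] hdeg htouch huP in
theorem card_nbrPos_le_of_notMem {a : V} (ha : a ∉ P) :
    (∀ x ∈ nbrPos H a P, 1 ≤ x ∧ x + 2 ≤ P.length) ∧ (nbrPos H a P).card ≤ k := by
  have hp : PathList H [a] := ⟨List.nodup_singleton a, List.isChain_singleton a⟩
  have h1 : ∀ x ∈ nbrPos H a P, 1 ≤ x ∧ x + 2 ≤ P.length := by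
    intro x hx
    obtain ⟨hxl, hax⟩ := mem_nbrPos.1 hx
    have := attach_bounds hP hmax hp (by simpa using ha) (a := a) (by simp) hxl hax
    rw [List.length_singleton] at this
    omega
  refine ⟨h1, ?_⟩
  have := card_le_of_gaps (S := nbrPos H a P) (a := 1) (b := P.length - 1)
    (fun x hx => ⟨(h1 x hx).1, by have := (h1 x hx).2; omega⟩) (fun x hx z hz hxz => by
      obtain ⟨hxl, hax⟩ := mem_nbrPos.1 hx
      obtain ⟨hzl, haz⟩ := mem_nbrPos.1 hz
      have := attach_gap hP hmax hp (by simpa using ha) (a := a) (b := a) (by simp) (by simp)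
        hxz hzl hax haz
      rw [List.length_singleton] at this
      omega)
  omega

end LongestPath

/-- In a graph without a path on `2 * k + 3` vertices whose edges all touch the neighbourhood of a
vertex `u`, whose other degrees are at least `k`, and in which no two adjacent vertices other than `u`
have degree `k`, all vertices off some small set `P` have `k` neighbours, and these are in a
set of at most `2 * k` vertices. -/
theorem exists_small_cover {V : Type*} [Fintype V] {H : SimpleGraph V} {k : ℕ} {u : V}
    (htouch : ∀ a b, H.Adj a b → H.Adj u a ∨ H.Adj u b)
    (hdeg : ∀ a b, H.Adj a b → a ≠ u → k ≤ deg H a)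
    (hpair : ∀ a b, H.Adj a b → a ≠ u → b ≠ u → ¬ (deg H a ≤ k ∧ deg H b ≤ k))
    (hfree : ∀ l, PathList H l → l.length ≤ 2 * k + 2) :
    ∃ P I : Finset V, I ⊆ P ∧ P.card ≤ 2 * k + 2 ∧ I.card ≤ 2 * k ∧
      ∀ a, a ∉ P → (∀ b, H.Adj a b → b ∈ I) ∧ deg H a ≤ k := by
  classical
  obtain ⟨P, hP, hmax⟩ := exists_longest_list (Q := PathList H) (fun l hl => hl.1)
    ⟨[], by simp [PathList]⟩
  have hlen := hfree P hP
  refine ⟨P.toFinset, (P.drop 1).dropLast.toFinset, ?_, ?_, ?_, ?_⟩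
  · intro v hv
    rw [List.mem_toFinset] at hv ⊢
    exact List.mem_of_mem_drop (List.mem_of_mem_dropLast hv)
  · exact (List.toFinset_card_le P).trans hlen
  · refine (List.toFinset_card_le _).trans ?_
    simp only [List.length_dropLast, List.length_drop]
    omega
  · intro a ha
    rw [List.mem_toFinset] at ha
    have h1 := card_nbrPos_le_of_notMem hP hmax hlen ha
    have hN : ∀ b, H.Adj a b → b ∈ P := fun b hb =>
      not_adj_off_longest hP hmax hlen htouch hdeg hpair ha hb
    constructor
    · intro b hb
      obtain ⟨x, hx, rfl⟩ := List.getElem_of_mem (hN b hb)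
      have hx' := h1.1 x (mem_nbrPos.2 ⟨hx, hb⟩)
      rw [List.mem_toFinset, List.mem_iff_getElem]
      refine ⟨x - 1, ?_, ?_⟩
      · simp only [List.length_dropLast, List.length_drop]; omega
      · simp only [List.getElem_dropLast, List.getElem_drop]
        congr 1; omega
    · have := deg_le_nbrPos_add (l := P) (m := []) (a := a) fun v hv => Or.inl (hN v hv)
      have h0 : (nbrPos H a ([] : List V)).card = 0 := by simp [nbrPos]
      omega

theorem nbrSum_one {V : Type*} [Fintype V] (G : SimpleGraph V) (i : V) :
    nbrSum G (fun _ => 1) i = deg G i := by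
  classical
  simp only [nbrSum, deg]
  rw [Finset.sum_boole]

/-- The numerical form of `n ≥ 2^{4k}` that leaves more than `(k+2) 4^k` vertices for the pigeonhole
step. -/
theorem pow_bound {k : ℕ} (hk : 2 ≤ k) :
    (k + 2) * 4 ^ k + 1 + 2 * (2 * k + 2) ^ 2 + 2 * k ^ 2 + 1 ≤ 2 ^ (4 * k) + 2 * k := by
  have h1 : 8 * k ≤ 4 ^ k := by
    induction k, hk using Nat.le_induction with
    | base => norm_num
    | succ m hm ih => rw [pow_succ]; omega
  have h2 : 2 ^ (4 * k) = 4 ^ k * 4 ^ k := by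
    rw [pow_mul, ← mul_pow]; norm_num
  rw [h2]
  generalize 4 ^ k = q at h1
  obtain ⟨r, rfl⟩ := Nat.exists_eq_add_of_le h1
  obtain ⟨s, rfl⟩ := Nat.exists_eq_add_of_le hk
  nlinarith [Nat.zero_le (r * s), Nat.zero_le (r * r), Nat.zero_le (s * s)]

/-! ### Extracting a biclique from the local degree count. -/

section Core

open Classical in
/-- Indicator of the edges at the neighbours of `u`. -/
noncomputable def nbrEdge {V : Type*} (G : SimpleGraph V) (u y z : V) : ℤ :=
  if G.Adj u y ∧ G.Adj y z then 1 else 0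

open Classical in
/-- The cost of a vertex in the potential `corePotential`. -/
noncomputable def coreCost {V : Type*} (G : SimpleGraph V) (u : V) (k : ℕ) (x : V) : ℤ :=
  if G.Adj u x then 4 * k - 5 else 2 * k - 1

/-- A potential of vertex sets whose maximisers have large degrees. -/
noncomputable def corePotential {V : Type*} (G : SimpleGraph V) (u : V) (k : ℕ)
    (X : Finset V) : ℤ :=
  2 * ∑ y ∈ X, ∑ z ∈ X, nbrEdge G u y z - ∑ x ∈ X, coreCost G u k x

/-- The edges inside `X ∪ {u}` that touch the neighbourhood of `u`. -/
def coreGraph {V : Type*} (G : SimpleGraph V) (u : V) (X : Finset V) : SimpleGraph V where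
  Adj a b := G.Adj a b ∧ (a = u ∨ a ∈ X) ∧ (b = u ∨ b ∈ X) ∧ (G.Adj u a ∨ G.Adj u b)
  symm := ⟨fun _ _ h => ⟨h.1.symm, h.2.2.1, h.2.1, h.2.2.2.symm⟩⟩
  loopless := ⟨fun _ h => h.1.ne rfl⟩

variable {V : Type*} {G : SimpleGraph V} {u : V} {k : ℕ} {X : Finset V}

theorem nbrEdge_nonneg (y z : V) : 0 ≤ nbrEdge G u y z := by
  unfold nbrEdge; split_ifs <;> simp

theorem nbrEdge_le_one (y z : V) : nbrEdge G u y z ≤ 1 := by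
  unfold nbrEdge; split_ifs <;> simp

theorem nbrEdge_self (y : V) : nbrEdge G u y y = 0 := by
  simp [nbrEdge]

theorem corePotential_sub [DecidableEq V] {S : Finset V} (hS : S ⊆ X) :
    corePotential G u k X - corePotential G u k (X \ S) =
      2 * (∑ t ∈ S, ∑ z ∈ X, nbrEdge G u t z + ∑ t ∈ S, ∑ y ∈ X \ S, nbrEdge G u y t)
        - ∑ t ∈ S, coreCost G u k t := by
  unfold corePotential
  have h1 := Finset.sum_sdiff (f := fun y => ∑ z ∈ X, nbrEdge G u y z) hS
  have h2 := Finset.sum_sdiff (f := coreCost G u k) hS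
  have h3 : ∑ y ∈ X \ S, ∑ z ∈ X, nbrEdge G u y z
      = ∑ y ∈ X \ S, ∑ z ∈ X \ S, nbrEdge G u y z + ∑ t ∈ S, ∑ y ∈ X \ S, nbrEdge G u y t := by
    rw [Finset.sum_comm (s := S), ← Finset.sum_add_distrib]
    exact Finset.sum_congr rfl fun y _ => (Finset.sum_sdiff hS).symm
  rw [← h1, ← h2, h3]
  ring

theorem corePotential_le (hk : 2 ≤ k) (Y : Finset V) :
    corePotential G u k Y ≤ 2 * (Y.card : ℤ) ^ 2 := by
  unfold corePotential
  have h1 : ∑ y ∈ Y, ∑ z ∈ Y, nbrEdge G u y z ≤ ∑ y ∈ Y, ∑ z ∈ Y, 1 :=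
    Finset.sum_le_sum fun y _ => Finset.sum_le_sum fun z _ => nbrEdge_le_one y z
  have h2 : 0 ≤ ∑ x ∈ Y, coreCost G u k x := Finset.sum_nonneg fun x _ => by
    unfold coreCost; split_ifs <;> omega
  simp only [Finset.sum_const, nsmul_eq_mul, mul_one] at h1
  nlinarith

theorem sum_nbrEdge_eq_zero {t : V} (ht : ¬ G.Adj u t) (Y : Finset V) :
    ∑ z ∈ Y, nbrEdge G u t z = 0 :=
  Finset.sum_eq_zero fun z _ => by simp [nbrEdge, ht]

theorem sum_nbrEdge_le {t : V} (ht : G.Adj u t) (Y : Finset V) :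
    ∑ y ∈ Y, nbrEdge G u y t ≤ ∑ z ∈ Y, nbrEdge G u t z := by
  refine Finset.sum_le_sum fun y _ => ?_
  unfold nbrEdge
  split_ifs with h1 h2 h2
  · rfl
  · exact absurd ⟨ht, h1.2.symm⟩ h2
  · simp
  · rfl

variable [Fintype V]

theorem deg_coreGraph_of_adj (hu : u ∉ X) {t : V} (htX : t ∈ X) (ht : G.Adj u t) :
    (deg (coreGraph G u X) t : ℤ) = ∑ z ∈ X, nbrEdge G u t z + 1 := by
  classical
  have : (Finset.univ.filter fun v => (coreGraph G u X).Adj t v)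
      = insert u (X.filter fun z => G.Adj t z) := by
    ext v
    simp only [Finset.mem_filter, Finset.mem_univ, true_and, Finset.mem_insert]
    constructor
    · rintro ⟨h1, -, rfl | h2, -⟩
      · exact Or.inl rfl
      · exact Or.inr ⟨h2, h1⟩
    · rintro (rfl | h)
      · exact ⟨ht.symm, Or.inr htX, Or.inl rfl, Or.inl ht⟩
      · exact ⟨h.2, Or.inr htX, Or.inr h.1, Or.inl ht⟩
  unfold deg
  rw [this, Finset.card_insert_of_notMem (by simp [hu])]
  simp [nbrEdge, ht]

theorem deg_coreGraph_of_not_adj {t : V} (htX : t ∈ X) (ht : ¬ G.Adj u t) :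
    (deg (coreGraph G u X) t : ℤ) = ∑ y ∈ X, nbrEdge G u y t := by
  classical
  have : (Finset.univ.filter fun v => (coreGraph G u X).Adj t v)
      = X.filter fun y => G.Adj u y ∧ G.Adj y t := by
    ext v
    simp only [Finset.mem_filter, Finset.mem_univ, true_and]
    constructor
    · rintro ⟨h1, -, rfl | h2, h3⟩
      · exact absurd h1.symm ht
      · exact ⟨h2, h3.resolve_left ht, h1.symm⟩
    · rintro ⟨h1, h2, h3⟩
      exact ⟨h3.symm, Or.inr htX, Or.inr h1, Or.inr h2⟩
  unfold deg
  rw [this]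
  simp [nbrEdge]

section Max

variable (hu : u ∉ X)
  (hmax : ∀ Y : Finset V, u ∉ Y → corePotential G u k Y ≤ corePotential G u k X)
include hu hmax

/-- Deleting `t` loses at most `4 (deg t - 1)` if `t` is adjacent to `u` and `2 deg t` otherwise,
and recovers the cost `4k - 5` or `2k - 1`. Each cost is one less than the bound on the loss at
degree `k`, so a smaller degree would make deletion profitable. -/
theorem le_deg_coreGraph {t : V} (ht : t ∈ X) : k ≤ deg (coreGraph G u X) t := by
  classical
  have h := corePotential_sub (G := G) (u := u) (k := k) (Finset.singleton_subset_iff.2 ht)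
  have h1 := hmax (X \ {t}) (by simp [hu])
  have h2 : ∑ y ∈ X \ {t}, nbrEdge G u y t = ∑ y ∈ X, nbrEdge G u y t := by
    rw [← Finset.sum_sdiff (Finset.singleton_subset_iff.2 ht)]
    simp [nbrEdge_self]
  simp only [Finset.sum_singleton, h2] at h
  zify
  by_cases hut : G.Adj u t
  · rw [deg_coreGraph_of_adj hu ht hut]
    have := sum_nbrEdge_le hut X
    simp only [coreCost, hut, if_true] at h
    omega
  · rw [deg_coreGraph_of_not_adj ht hut]
    simp only [coreCost, hut, if_false, sum_nbrEdge_eq_zero hut] at h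
    omega

/-- The edge between `s` and `t` is counted in both degrees but lost only once. Deleting both
endpoints would therefore increase the potential if neither degree exceeded `k`. -/
theorem not_deg_coreGraph_le {s t : V} (hs : s ∈ X) (ht : t ∈ X)
    (hst : (coreGraph G u X).Adj s t) :
    ¬ (deg (coreGraph G u X) s ≤ k ∧ deg (coreGraph G u X) t ≤ k) := by
  classical
  wlog hus : G.Adj u s generalizing s t
  · rw [and_comm]
    exact this ht hs hst.symm (hst.2.2.2.resolve_left hus)
  rintro ⟨hds, hdt⟩
  have hne : s ≠ t := hst.ne
  have hadj : G.Adj s t := hst.1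
  have hsub : ({s, t} : Finset V) ⊆ X := by
    intro v hv
    simp only [Finset.mem_insert, Finset.mem_singleton] at hv
    rcases hv with rfl | rfl <;> assumption
  have h := corePotential_sub (G := G) (u := u) (k := k) hsub
  have h1 := hmax (X \ {s, t}) (by simp [hu])
  have h2 : ∀ v, ∑ y ∈ X \ {s, t}, nbrEdge G u y v
      = ∑ y ∈ X, nbrEdge G u y v - (nbrEdge G u s v + nbrEdge G u t v) := by
    intro v
    rw [← Finset.sum_sdiff hsub, Finset.sum_pair hne]
    ring
  rw [Finset.sum_pair hne, Finset.sum_pair hne, Finset.sum_pair hne, h2, h2, nbrEdge_self,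
    nbrEdge_self] at h
  zify at hds hdt
  rw [deg_coreGraph_of_adj hu hs hus] at hds
  have hwst : nbrEdge G u s t = 1 := by simp [nbrEdge, hus, hadj]
  by_cases hut : G.Adj u t
  · rw [deg_coreGraph_of_adj hu ht hut] at hdt
    have hwts : nbrEdge G u t s = 1 := by simp [nbrEdge, hut, hadj.symm]
    have := sum_nbrEdge_le hut X
    have := sum_nbrEdge_le hus X
    simp only [coreCost, hut, hus, if_true] at h
    omega
  · rw [deg_coreGraph_of_not_adj ht hut] at hdt
    have hwts : nbrEdge G u t s = 0 := by simp [nbrEdge, hut]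
    have h3 : ∑ y ∈ X, nbrEdge G u y s + 1 ≤ ∑ z ∈ X, nbrEdge G u s z := by
      have hX : X = insert t (X.erase t) := (Finset.insert_erase ht).symm
      rw [hX, Finset.sum_insert (by simp), Finset.sum_insert (by simp), hwst, hwts]
      have := sum_nbrEdge_le hus (X.erase t)
      omega
    simp only [coreCost, hut, hus, if_true, if_false, sum_nbrEdge_eq_zero hut] at h
    omega

omit hmax in
-- With the chosen costs, a vertex of degree at most `k` contributes at most `1`, and the vertices
-- in `P` contribute a bounded amount.
theorem corePotential_le_card_sdiff [DecidableEq V] (hk : 2 ≤ k) {P : Finset V}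
    (hP : P.card ≤ 2 * k + 2) (hoff : ∀ a, a ∉ P → deg (coreGraph G u X) a ≤ k) :
    corePotential G u k X ≤ (X \ P).card + 2 * (2 * (k : ℤ) + 2) ^ 2 := by
  have h := corePotential_sub (G := G) (u := u) (k := k) (Finset.sdiff_subset (s := X) (t := P))
  have h1 := corePotential_le (G := G) (u := u) hk (X \ (X \ P))
  have h2 : (X \ (X \ P)).card ≤ 2 * k + 2 := by
    refine (Finset.card_le_card ?_).trans hP
    rw [sdiff_sdiff_right_self]
    exact Finset.inter_subset_right
  have h3 : ((X \ (X \ P)).card : ℤ) ^ 2 ≤ (2 * (k : ℤ) + 2) ^ 2 := by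
    refine pow_le_pow_left₀ (by positivity) ?_ 2
    exact_mod_cast h2
  have h4 : 2 * (∑ t ∈ X \ P, ∑ z ∈ X, nbrEdge G u t z
      + ∑ t ∈ X \ P, ∑ y ∈ X \ (X \ P), nbrEdge G u y t) - ∑ t ∈ X \ P, coreCost G u k t
      ≤ ∑ t ∈ X \ P, (1 : ℤ) := by
    rw [← Finset.sum_add_distrib, Finset.mul_sum, ← Finset.sum_sub_distrib]
    refine Finset.sum_le_sum fun t ht => ?_
    rw [Finset.mem_sdiff] at ht
    have hd := hoff t ht.2
    have hle : ∑ y ∈ X \ (X \ P), nbrEdge G u y t ≤ ∑ y ∈ X, nbrEdge G u y t :=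
      Finset.sum_le_sum_of_subset_of_nonneg Finset.sdiff_subset
        fun y _ _ => nbrEdge_nonneg y t
    zify at hd
    by_cases hut : G.Adj u t
    · rw [deg_coreGraph_of_adj hu ht.1 hut] at hd
      have := sum_nbrEdge_le hut X
      simp only [coreCost, hut, if_true]
      omega
    · rw [deg_coreGraph_of_not_adj ht.1 hut] at hd
      simp only [coreCost, hut, if_false, sum_nbrEdge_eq_zero hut]
      omega
  simp only [Finset.sum_const, nsmul_eq_mul, mul_one] at h4
  linarith

end Max

/-- The costs at neighbours of `u` exceed the others by `2k - 4`; together with the `-2` for each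
neighbour from the edges to `u`, this makes up twice the term `(k-1) deg u`. The potential of the
full set is thus at least `2k (n-k) - (2k-1)(n-1)`. -/
theorem le_corePotential [DecidableEq V]
    (h : (k : ℝ) * (Fintype.card V - k) ≤
      nbrSum G (nbrSum G fun _ => 1) u - (k - 1) * nbrSum G (fun _ => 1) u) :
    (Fintype.card V : ℤ) - 2 * k ^ 2 + 2 * k - 1 ≤ corePotential G u k (Finset.univ.erase u) := by
  classical
  have hdeg : ∀ y, G.Adj u y →
      ∑ z ∈ Finset.univ.erase u, nbrEdge G u y z = (deg G y : ℤ) - 1 := by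
    intro y hy
    have h1 := Finset.add_sum_erase Finset.univ (nbrEdge G u y) (Finset.mem_univ u)
    have h2 : ∑ z, nbrEdge G u y z = deg G y := by
      simp [nbrEdge, hy, deg]
    have h3 : nbrEdge G u y u = 1 := by simp [nbrEdge, hy, hy.symm]
    linarith
  have hsum : ∑ y ∈ Finset.univ.erase u, ∑ z ∈ Finset.univ.erase u, nbrEdge G u y z
      = ∑ y, if G.Adj u y then (deg G y : ℤ) - 1 else 0 := by
    rw [← Finset.add_sum_erase Finset.univ _ (Finset.mem_univ u)]
    simp only [SimpleGraph.irrefl, if_false, zero_add]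
    refine Finset.sum_congr rfl fun y _ => ?_
    split_ifs with hy
    · exact hdeg y hy
    · exact sum_nbrEdge_eq_zero hy _
  have hcost : ∑ x ∈ Finset.univ.erase u, coreCost G u k x
      = (2 * k - 4) * (deg G u : ℤ) + (2 * k - 1) * ((Fintype.card V : ℤ) - 1) := by
    have h1 := Finset.add_sum_erase Finset.univ (coreCost G u k) (Finset.mem_univ u)
    have h2 : ∑ x, coreCost G u k x
        = (2 * k - 4) * (deg G u : ℤ) + (2 * k - 1) * (Fintype.card V : ℤ) := by
      have : ∀ x, coreCost G u k x = (2 * k - 4) * (if G.Adj u x then 1 else 0) + (2 * k - 1) := by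
        intro x; unfold coreCost; split_ifs <;> ring
      simp only [this, Finset.sum_add_distrib, ← Finset.mul_sum, Finset.sum_boole,
        Finset.sum_const, nsmul_eq_mul, Finset.card_univ, deg]
      ring
    have h3 : coreCost G u k u = 2 * k - 1 := by simp [coreCost]
    rw [h2, h3] at h1
    linarith
  have hdegs : (∑ y, if G.Adj u y then (deg G y : ℤ) - 1 else 0)
      = (∑ y, if G.Adj u y then (deg G y : ℤ) else 0) - deg G u := by
    have : ∀ y, (if G.Adj u y then (deg G y : ℤ) - 1 else 0)
        = (if G.Adj u y then (deg G y : ℤ) else 0) - (if G.Adj u y then 1 else 0) := by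
      intro y; split_ifs <;> simp
    rw [Finset.sum_congr rfl fun y _ => this y, Finset.sum_sub_distrib, Finset.sum_boole]
    rfl
  have hreal : nbrSum G (nbrSum G fun _ => 1) u
      = ((∑ y, if G.Adj u y then (deg G y : ℤ) else 0 : ℤ) : ℝ) := by
    have : nbrSum G (fun _ => 1) = fun i => (deg G i : ℝ) := funext (nbrSum_one G)
    rw [this]
    simp only [nbrSum, Int.cast_sum]
    refine Finset.sum_congr rfl fun y _ => ?_
    split_ifs <;> simp
  rw [hreal, nbrSum_one] at h
  have hz : (k : ℤ) * (Fintype.card V - k) ≤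
      (∑ y, if G.Adj u y then (deg G y : ℤ) else 0) - (k - 1) * deg G u := by
    exact_mod_cast h
  unfold corePotential
  rw [hsum, hcost, hdegs]
  linarith

/-- The last clause says that `u` is reachable from `L`. It ties the biclique to a component where
the eigenvector does not vanish. -/
theorem exists_biclique (hk : 2 ≤ k) (hn : 2 ^ (4 * k) ≤ Fintype.card V)
    (h : (k : ℝ) * (Fintype.card V - k) ≤
      nbrSum G (nbrSum G fun _ => 1) u - (k - 1) * nbrSum G (fun _ => 1) u)
    (hfree : ∀ l, PathList G l → l.length ≤ 2 * k + 2) :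
    ∃ L M : Finset V, L.card = k ∧ k + 3 ≤ M.card ∧ (∀ l ∈ L, ∀ m ∈ M, G.Adj l m) ∧
      ∀ C : Set V, (∀ a ∈ C, ∀ b, G.Adj a b → b ∈ C) → (∀ l ∈ L, l ∈ C) → u ∈ C := by
  classical
  obtain ⟨X, hX, hXmax⟩ := Finset.exists_max_image
    (Finset.univ.filter fun Y : Finset V => u ∉ Y) (corePotential G u k)
    ⟨∅, by simp⟩
  have hu : u ∉ X := (Finset.mem_filter.1 hX).2
  have hmax : ∀ Y : Finset V, u ∉ Y → corePotential G u k Y ≤ corePotential G u k X :=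
    fun Y hY => hXmax Y (Finset.mem_filter.2 ⟨Finset.mem_univ _, hY⟩)
  set H := coreGraph G u X with hH
  have hmem : ∀ a b, H.Adj a b → a ≠ u → a ∈ X := fun a b hab ha => hab.2.1.resolve_left ha
  obtain ⟨P, I, -, hPc, hIc, hoff⟩ := exists_small_cover (H := H) (k := k) (u := u)
    (fun a b hab => by
      have key : ∀ c, (c = u ∨ c ∈ X) → G.Adj u c → H.Adj u c := fun c hc huc =>
        ⟨huc, Or.inl rfl, hc, Or.inr huc⟩
      exact hab.2.2.2.imp (key a hab.2.1) (key b hab.2.2.1))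
    (fun a b hab ha => le_deg_coreGraph hu hmax (hmem a b hab ha))
    (fun a b hab ha hb => not_deg_coreGraph_le hu hmax (hmem a b hab ha)
      (hmem b a hab.symm hb) hab)
    (fun l hl => hfree l (hl.mono fun a b (hab : H.Adj a b) => hab.1))
  have h1 := corePotential_le_card_sdiff hu hk hPc fun a ha => (hoff a ha).2
  have h2 := (le_corePotential h).trans (hmax _ (by simp))
  have hcard : (k + 2) * 4 ^ k < (X \ P).card := by
    have h3 := (pow_bound hk).trans (Nat.add_le_add_right hn _)
    zify at h3 ⊢
    linarith
  -- The neighbourhoods of vertices off `P` are among at most `4^k` subsets of `I`, so some subset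
  -- occurs more than `k + 2` times.
  have hpow : I.powerset.card * (k + 2) < (X \ P).card := by
    refine lt_of_le_of_lt ?_ hcard
    rw [Finset.card_powerset, mul_comm]
    refine Nat.mul_le_mul_left _ ?_
    calc 2 ^ I.card ≤ 2 ^ (2 * k) := Nat.pow_le_pow_right (by norm_num) hIc
      _ = 4 ^ k := by rw [pow_mul]; norm_num
  obtain ⟨L, -, hL⟩ := Finset.exists_lt_card_fiber_of_mul_lt_card_of_maps_to
    (f := fun t => Finset.univ.filter fun v => H.Adj t v) (fun t ht => by
      rw [Finset.mem_powerset]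
      intro v hv
      exact (hoff t (Finset.mem_sdiff.1 ht).2).1 v (Finset.mem_filter.1 hv).2) hpow
  obtain ⟨t, ht⟩ := Finset.card_pos.1 ((Nat.zero_le _).trans_lt hL)
  rw [Finset.mem_filter, Finset.mem_sdiff] at ht
  have htdeg : deg H t = L.card := by rw [← ht.2]; unfold deg; congr!
  have hge := le_deg_coreGraph hu hmax ht.1.1
  refine ⟨L, _, le_antisymm (htdeg ▸ (hoff t ht.1.2).2) (htdeg ▸ hge), hL, ?_, ?_⟩
  · intro l hl m hm
    rw [← (Finset.mem_filter.1 hm).2, Finset.mem_filter] at hl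
    exact hl.2.1.symm
  · intro C hC hLC
    obtain ⟨l, hl⟩ : L.Nonempty := by
      rw [← Finset.card_pos, ← htdeg]
      exact lt_of_lt_of_le (by omega) hge
    have hlC := hLC l hl
    rw [← ht.2, Finset.mem_filter] at hl
    have htl : H.Adj t l := hl.2
    have htC := hC l hlC t htl.1.symm
    rcases htl.2.2.2 with h | h
    · exact hC t htC u h.symm
    · exact hC l hlC u h.symm

end Core

/-! ### From the biclique to the extremal graphs. -/

section Join

/-- The join of the complete graph on `L` and the edgeless graph on the other vertices. -/
def joinGraph {V : Type*} (L : Finset V) : SimpleGraph V where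
  Adj a b := a ≠ b ∧ (a ∈ L ∨ b ∈ L)
  symm := ⟨fun _ _ h => ⟨h.1.symm, h.2.symm⟩⟩
  loopless := ⟨fun _ h => h.1 rfl⟩

/-- The graph `joinGraph L` with the edge `a b` added. -/
def joinPlus {V : Type*} (L : Finset V) (a b : V) : SimpleGraph V where
  Adj i j := i ≠ j ∧ (i ∈ L ∨ j ∈ L ∨ (i = a ∧ j = b) ∨ (i = b ∧ j = a))
  symm := ⟨fun _ _ h => ⟨h.1.symm, by tauto⟩⟩
  loopless := ⟨fun _ h => h.1 rfl⟩

variable {V : Type*} {G : SimpleGraph V} {L M : Finset V} {k : ℕ}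

/-- Each vertex of `ls` is followed by a fresh vertex of `M`; `F` holds the vertices used so far or
reserved for other parts of a path. -/
theorem exists_zigzag (M : Finset V) : ∀ (ls : List V) (F : Finset V), ls.Nodup →
    (∀ l ∈ ls, ∀ m ∈ M, G.Adj l m) → ls.length + F.card ≤ M.card →
    ∃ z, PathList G z ∧ z.length = 2 * ls.length ∧ z.head? = ls.head? ∧
      (∀ v ∈ z, v ∈ ls ∨ (v ∈ M ∧ v ∉ F)) ∧ ∀ v ∈ z.getLast?, v ∈ M := by
  classical
  intro ls
  induction ls with
  | nil => intro F _ _ _; exact ⟨[], by simp [PathList]⟩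
  | cons l ls ih =>
    intro F hnd hadj hcard
    rw [List.nodup_cons] at hnd
    simp only [List.length_cons] at hcard
    obtain ⟨m, hmM, hmF⟩ := Finset.exists_mem_notMem_of_card_lt_card (s := F) (t := M) (by omega)
    have hc : (insert m F).card = F.card + 1 := Finset.card_insert_of_notMem hmF
    obtain ⟨z, hz, hlen, hhead, hmem, hlast⟩ := ih (insert m F) hnd.2
      (fun l' hl' => hadj l' (List.mem_cons_of_mem _ hl')) (by omega)
    have hlm := hadj l List.mem_cons_self m hmM
    have hmz : m ∉ z := by
      intro h
      rcases hmem m h with h | h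
      · exact (hadj m (List.mem_cons_of_mem _ h) m hmM).ne rfl
      · exact h.2 (Finset.mem_insert_self _ _)
    have hlz : l ∉ z := by
      intro h
      rcases hmem l h with h | h
      · exact hnd.1 h
      · exact (hadj l List.mem_cons_self l h.1).ne rfl
    refine ⟨[l, m] ++ z, ?_, ?_, by simp, ?_, ?_⟩
    · refine PathList.append ⟨by simp [hlm.ne], List.isChain_pair.2 hlm⟩ hz ?_ ?_
      · intro v hv
        simp only [List.mem_cons, List.not_mem_nil, or_false] at hv
        rcases hv with rfl | rfl <;> assumption
      · intro a ha b hb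
        simp only [List.getLast?_cons_cons, List.getLast?_singleton, Option.mem_def,
          Option.some.injEq] at ha
        rw [hhead] at hb
        rw [← ha]
        exact (hadj b (List.mem_cons_of_mem _ (List.mem_of_mem_head? hb)) m hmM).symm
    · simp [hlen]; omega
    · intro v hv
      simp only [List.cons_append, List.nil_append, List.mem_cons] at hv
      rcases hv with rfl | rfl | hv
      · exact Or.inl List.mem_cons_self
      · exact Or.inr ⟨hmM, hmF⟩
      · rcases hmem v hv with h | h
        · exact Or.inl (List.mem_cons_of_mem _ h)
        · exact Or.inr ⟨h.1, fun h' => h.2 (Finset.mem_insert_of_mem h')⟩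
    · intro v hv
      rcases z.eq_nil_or_concat with rfl | ⟨z', w, rfl⟩
      · simp only [List.append_nil, List.getLast?_cons_cons, List.getLast?_singleton,
          Option.mem_def, Option.some.injEq] at hv
        rw [← hv]; exact hmM
      · rw [List.getLast?_append_of_ne_nil _ (by simp)] at hv
        exact hlast v hv

section Biclique

variable (hLk : L.card = k) (hM : k + 3 ≤ M.card) (hLM : ∀ l ∈ L, ∀ m ∈ M, G.Adj l m)
include hLk hM hLM

theorem exists_long_path {p : List V} (hp : PathList G p) (hpL : ∀ v ∈ p, v ∉ L)
    (hp3 : p.length ≤ 3) {a l : V} (ha : a ∈ p.getLast?) (hl : l ∈ L) (hal : G.Adj a l) :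
    ∃ q, PathList G q ∧ q.length = p.length + 2 * k := by
  classical
  have hlen : (l :: (L.erase l).toList).length = k := by
    simp only [List.length_cons, Finset.length_toList, Finset.card_erase_of_mem hl]
    have := Finset.card_pos.2 ⟨l, hl⟩
    omega
  have hsub : ∀ v ∈ l :: (L.erase l).toList, v ∈ L := by
    intro v hv
    simp only [List.mem_cons, Finset.mem_toList, Finset.mem_erase] at hv
    rcases hv with rfl | hv
    · exact hl
    · exact hv.2
  obtain ⟨z, hz, hzl, hhead, hmem, -⟩ := exists_zigzag (G := G) M (l :: (L.erase l).toList)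
    p.toFinset (List.nodup_cons.2 ⟨by simp, Finset.nodup_toList _⟩)
    (fun v hv => hLM v (hsub v hv)) (by
      have := List.toFinset_card_le p
      omega)
  refine ⟨p ++ z, hp.append hz ?_ ?_, by rw [List.length_append, hzl, hlen]⟩
  · intro v hv hvz
    rcases hmem v hvz with h | h
    · exact hpL v hv (hsub v h)
    · exact h.2 (List.mem_toFinset.2 hv)
  · intro b hb c hc
    rw [hhead, List.head?_cons, Option.mem_def, Option.some.injEq] at hc
    rw [Option.mem_def] at ha hb
    rw [ha] at hb
    cases hb
    rw [← hc]; exact hal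

/-- The path runs `a', a, l`, zigzags through `L` without `l'`, and ends with `l', b, b'`. Avoiding
four vertices with `k - 1` zigzag steps is what requires `k + 3` vertices in `M`. For `k = 1` the
single vertex of `L` joins both edges. -/
theorem exists_long_path_of_two_edges {a a' b b' l l' : V} (haa : G.Adj a a')
    (hbb : G.Adj b b') (haL : a ∉ L) (haL' : a' ∉ L) (hbL : b ∉ L) (hbL' : b' ∉ L)
    (hd : a ≠ b ∧ a ≠ b' ∧ a' ≠ b ∧ a' ≠ b') (hl : l ∈ L) (hl' : l' ∈ L) (hal : G.Adj a l)
    (hbl : G.Adj b l') (hne : l ≠ l' ∨ k = 1) : ∃ q, PathList G q ∧ q.length = 2 * k + 3 := by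
  classical
  have hp : PathList G [a', a] := ⟨by simp [haa.ne'], List.isChain_pair.2 haa.symm⟩
  have hq : PathList G [l', b, b'] := by
    refine ⟨?_, ?_⟩
    · simp only [List.nodup_cons, List.mem_cons, List.not_mem_nil, or_false, not_or,
        not_false_eq_true, List.nodup_nil, and_true]
      exact ⟨⟨fun h => hbL (h ▸ hl'), fun h => hbL' (h ▸ hl')⟩, hbb.ne⟩
    · exact List.IsChain.cons_cons hbl.symm (List.isChain_pair.2 hbb)
  have hpq : ∀ v ∈ [a', a], v ∉ [l', b, b'] := by
    intro v hv
    simp only [List.mem_cons, List.not_mem_nil, or_false, not_or] at hv ⊢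
    rcases hv with rfl | rfl
    · exact ⟨fun h => haL' (h ▸ hl'), hd.2.2.1, hd.2.2.2⟩
    · exact ⟨fun h => haL (h ▸ hl'), hd.1, hd.2.1⟩
  by_cases hll : l = l'
  · have hk1 : k = 1 := hne.resolve_left fun h => h hll
    refine ⟨_, hp.append hq hpq ?_, by simp [hk1]⟩
    intro c hc e he
    simp only [List.getLast?_cons_cons, List.getLast?_singleton, List.head?_cons,
      Option.mem_def, Option.some.injEq] at hc he
    rw [← hc, ← he, ← hll]; exact hal
  · have hmem' : l ∈ L.erase l' := Finset.mem_erase.2 ⟨hll, hl⟩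
    have hlen : (l :: ((L.erase l').erase l).toList).length + 1 = k := by
      simp only [List.length_cons, Finset.length_toList, Finset.card_erase_of_mem hmem',
        Finset.card_erase_of_mem hl']
      have h1 := Finset.card_pos.2 ⟨l, hmem'⟩
      rw [Finset.card_erase_of_mem hl'] at h1
      omega
    have hsub : ∀ v ∈ l :: ((L.erase l').erase l).toList, v ∈ L ∧ v ≠ l' := by
      intro v hv
      simp only [List.mem_cons, Finset.mem_toList, Finset.mem_erase] at hv
      rcases hv with rfl | hv
      · exact ⟨hl, hll⟩
      · exact ⟨hv.2.2, hv.2.1⟩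
    obtain ⟨z, hz, hzl, hhead, hmem, hlast⟩ := exists_zigzag (G := G) M
      (l :: ((L.erase l').erase l).toList) {a, a', b, b'}
      (List.nodup_cons.2 ⟨by simp, Finset.nodup_toList _⟩)
      (fun v hv => hLM v (hsub v hv).1) (by
        have := Finset.card_le_four (a := a) (b := a') (c := b) (d := b')
        omega)
    have hzne : z ≠ [] := by
      rintro rfl
      simp at hhead
    have hpz : PathList G ([a', a] ++ z) := by
      refine hp.append hz ?_ ?_
      · intro v hv hvz
        simp only [List.mem_cons, List.not_mem_nil, or_false] at hv
        rcases hmem v hvz with h | h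
        · rcases hv with rfl | rfl
          · exact haL' (hsub _ h).1
          · exact haL (hsub _ h).1
        · rcases hv with rfl | rfl <;> simp at h
      · intro c hc e he
        rw [hhead] at he
        simp only [List.getLast?_cons_cons, List.getLast?_singleton, List.head?_cons,
          Option.mem_def, Option.some.injEq] at hc he
        rw [← hc, ← he]; exact hal
    refine ⟨_, hpz.append hq ?_ ?_, ?_⟩
    · intro v hv hvq
      rcases List.mem_append.1 hv with hv | hv
      · exact hpq v hv hvq
      · simp only [List.mem_cons, List.not_mem_nil, or_false] at hvq
        rcases hmem v hv with h | h
        · rcases hvq with rfl | rfl | rfl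
          · exact (hsub _ h).2 rfl
          · exact hbL (hsub _ h).1
          · exact hbL' (hsub _ h).1
        · rcases hvq with rfl | rfl | rfl
          · exact (hLM _ hl' _ h.1).ne rfl
          · simp at h
          · simp at h
    · intro c hc e he
      rw [List.getLast?_append_of_ne_nil _ hzne] at hc
      rw [List.head?_cons, Option.mem_def, Option.some.injEq] at he
      rw [← he]
      exact (hLM l' hl' c (hlast c hc)).symm
    · simp only [List.length_append, hzl, List.length_cons, List.length_nil] at hlen ⊢
      omega

variable [Fintype V] {c : ℝ} {x : V → ℝ} {u : V} (h0 : ∀ i, 0 ≤ x i)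
  (he : ∀ i, nbrSum G x i = c * x i) (hxu : 0 < x u)
  (hu : ∀ C : Set V, (∀ a ∈ C, ∀ b, G.Adj a b → b ∈ C) → (∀ l ∈ L, l ∈ C) → u ∈ C)
include h0 he hxu hu

/-- An edge outside `L` with an end attached to `L` would extend a zigzag to `2k + 2` vertices.
Hence `L` and its neighbours form a closed set in which all edges meet `L`. -/
theorem eq_joinGraph (hk : 1 ≤ k) (hmu : graphMu (joinGraph L) ≤ c)
    (hfree : ∀ l, PathList G l → l.length ≤ 2 * k + 1) : G = joinGraph L := by
  have key : ∀ a b l, a ∉ L → b ∉ L → l ∈ L → G.Adj a l → ¬ G.Adj a b := by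
    intro a b l ha hb hl hal hab
    obtain ⟨q, hq, hql⟩ := exists_long_path hLk hM hLM (p := [b, a])
      ⟨by simp [hab.ne'], List.isChain_pair.2 hab.symm⟩ (by simp [ha, hb]) (by simp)
      (a := a) (by simp) hl hal
    have := hfree q hq
    simp only [List.length_cons, List.length_nil] at hql
    omega
  obtain ⟨l0, hl0⟩ : L.Nonempty := Finset.card_pos.1 (by omega)
  let C : Set V := {v | v ∈ L ∨ ∃ l ∈ L, G.Adj v l}
  have hC : ∀ a ∈ C, ∀ b, G.Adj a b → b ∈ C := by
    intro a ha b hab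
    by_cases haL : a ∈ L
    · exact Or.inr ⟨a, haL, hab.symm⟩
    · obtain ⟨l, hl, hal⟩ := ha.resolve_left haL
      by_cases hbL : b ∈ L
      · exact Or.inl hbL
      · exact absurd hab (key a b l haL hbL hl hal)
  refine eq_of_closed_le (l := l0) (fun j hj => ⟨hj.symm, Or.inl hl0⟩) hmu h0 he hC
    (hu C hC fun l hl => Or.inl hl) hxu ?_
  intro i hi j _ hij
  refine ⟨hij.ne, ?_⟩
  by_contra! hcon
  obtain ⟨l, hl, hil⟩ := hi.resolve_left hcon.1
  exact key i j l hcon.1 hcon.2 hl hil hij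

theorem eq_joinPlus (hk : 1 ≤ k) (hc2 : 2 ≤ c)
    (hcn : (k : ℝ) * (Fintype.card V - k) < c ^ 2 - (k - 1) * c)
    (hmu : ∀ a b, a ∉ L → b ∉ L → a ≠ b → graphMu (joinPlus L a b) ≤ c)
    (hfree : ∀ l, PathList G l → l.length ≤ 2 * k + 2) :
    ∃ a b, a ∉ L ∧ b ∉ L ∧ a ≠ b ∧ G = joinPlus L a b := by
  classical
  -- Such a path on three vertices, continued by a zigzag from `l`, would have `2k + 3` vertices.
  have hF1 : ∀ a b d l, a ∉ L → b ∉ L → d ∉ L → a ≠ d → l ∈ L → G.Adj d l → G.Adj a b →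
      ¬ G.Adj b d := by
    intro a b d l ha hb hd had hl hdl hab hbd
    obtain ⟨q, hq, hql⟩ := exists_long_path hLk hM hLM (p := [a, b, d])
      ⟨by simp [hab.ne, hbd.ne, had], List.IsChain.cons_cons hab (List.isChain_pair.2 hbd)⟩
      (by simp [ha, hb, hd]) (by simp) (a := d) (by simp) hl hdl
    have := hfree q hq
    simp only [List.length_cons, List.length_nil] at hql
    omega
  obtain ⟨l0, hl0⟩ : L.Nonempty := Finset.card_pos.1 (by omega)
  let R : V → Prop := fun v => v ∉ L ∧ ∃ l ∈ L, G.Adj v l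
  let C : Set V := {v | v ∈ L ∨ R v ∨ ∃ a, R a ∧ G.Adj a v}
  have hCR : ∀ i j, i ∈ C → i ∉ L → j ∉ L → G.Adj i j → R i ∨ R j := by
    intro i j hi hiL hjL hij
    by_contra! hcon
    obtain ⟨a, ⟨haL, l, hl, hal⟩, hai⟩ := (hi.resolve_left hiL).resolve_left hcon.1
    refine hF1 j i a l hjL hiL haL (fun h => hcon.2 (h ▸ ⟨haL, l, hl, hal⟩)) hl hal hij.symm
      hai.symm
  have hC : ∀ a ∈ C, ∀ b, G.Adj a b → b ∈ C := by
    intro a ha b hab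
    by_cases hbL : b ∈ L
    · exact Or.inl hbL
    by_cases haL : a ∈ L
    · exact Or.inr (Or.inl ⟨hbL, a, haL, hab.symm⟩)
    rcases hCR a b ha haL hbL hab with h | h
    · exact Or.inr (Or.inr ⟨a, h, hab⟩)
    · exact Or.inr (Or.inl h)
  have huC : u ∈ C := hu C hC fun l hl => Or.inl hl
  by_cases hone : ∃ a b, a ∉ L ∧ b ∉ L ∧ a ≠ b ∧ ∀ i ∈ C, ∀ j, i ∉ L → j ∉ L → G.Adj i j →
      (i = a ∧ j = b) ∨ (i = b ∧ j = a)
  · obtain ⟨a, b, ha, hb, hab, hall⟩ := hone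
    refine ⟨a, b, ha, hb, hab, ?_⟩
    refine eq_of_closed_le (l := l0) (fun j hj => ⟨hj.symm, Or.inl hl0⟩) (hmu a b ha hb hab)
      h0 he hC huC hxu ?_
    intro i hi j _ hij
    refine ⟨hij.ne, ?_⟩
    by_cases hiL : i ∈ L
    · exact Or.inl hiL
    by_cases hjL : j ∈ L
    · exact Or.inr (Or.inl hjL)
    exact Or.inr (Or.inr (hall i hi j hiL hjL hij))
  exfalso
  push Not at hone
  have hc0 : 0 < c := by linarith
  set X := ∑ l ∈ L, x l with hX
  have hX0 : 0 ≤ X := Finset.sum_nonneg fun l _ => h0 l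
  have hxX : ∀ l ∈ L, x l ≤ X := fun l hl => Finset.single_le_sum (fun i _ => h0 i) hl
  -- the eigenvalue equation, split along `L`
  have hsplit : ∀ b, c * x b = ∑ l ∈ L, (if G.Adj b l then x l else 0)
      + ∑ j ∈ Lᶜ, (if G.Adj b j then x j else 0) := by
    intro b
    rw [← he, Finset.sum_add_sum_compl]
    exact Finset.sum_congr rfl fun j _ => by congr
  have hLle : ∀ b, ∑ l ∈ L, (if G.Adj b l then x l else 0) ≤ X := fun b =>
    Finset.sum_le_sum fun l _ => by split_ifs <;> simp [h0]
  have hXpos : 0 < X := by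
    refine lt_of_le_of_ne hX0 fun h => ?_
    have hzero : ∀ i, x i = 0 → ∀ j, G.Adj i j → x j = 0 := by
      intro i hi j hij
      have h := he i
      rw [hi, mul_zero] at h
      have := (Finset.sum_eq_zero_iff_of_nonneg (fun j _ => by split_ifs <;> simp [h0])).1 h j
        (Finset.mem_univ j)
      simpa [hij] using this
    have hL0 : ∀ l ∈ L, x l = 0 := fun l hl => le_antisymm (h ▸ hxX l hl) (h0 l)
    have hR0 : ∀ a, R a → x a = 0 := by
      rintro a ⟨-, l, hl, hal⟩
      exact hzero l (hL0 l hl) a hal.symm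
    rcases huC with h | h | ⟨a, ha, hau⟩
    · exact hxu.ne' (hL0 u h)
    · exact hxu.ne' (hR0 u h)
    · exact hxu.ne' (hzero a (hR0 a ha) u hau)
  let Q : V → Finset V := fun b => Lᶜ.filter fun j => G.Adj b j ∧ ¬ R j
  let dL : V → ℕ := fun b => (L.filter fun l => G.Adj b l).card
  have hdLk : ∀ b, dL b ≤ k := fun b => (Finset.card_filter_le _ _).trans hLk.le
  let T : V → Finset V := fun b => insert b (Q b)
  have hbQ : ∀ b, b ∉ Q b := by
    intro b hb
    exact (Finset.mem_filter.1 hb).2.1.ne rfl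
  have hTcard : ∀ b, (T b).card = (Q b).card + 1 := fun b =>
    Finset.card_insert_of_notMem (hbQ b)
  have hTL : ∀ b, R b → T b ⊆ Lᶜ := by
    intro b hb v hv
    rcases Finset.mem_insert.1 hv with rfl | hv
    · exact Finset.mem_compl.2 hb.1
    · exact (Finset.mem_filter.1 hv).1
  have hLc : (Lᶜ.card : ℝ) = Fintype.card V - k := by
    rw [Finset.card_compl, hLk, Nat.cast_sub (hLk ▸ Finset.card_le_univ L)]
  -- Each attached vertex is charged to itself and its leaves in `T b`: it may weigh no more than
  -- `|T b|` independent vertices joined to all of `L` would.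
  have hroot : ∀ b, R b → (dL b : ℝ) * x b ≤ (T b).card * (k * X / c) := by
    intro b hb
    obtain ⟨hbL, l, hl, hbl⟩ := hb
    have hRb : R b := ⟨hbL, l, hl, hbl⟩
    have hbC : b ∈ C := Or.inr (Or.inl hRb)
    have hdb : (dL b : ℝ) * x b ≤ k * x b :=
      mul_le_mul_of_nonneg_right (by exact_mod_cast hdLk b) (h0 b)
    have hk0 : (0 : ℝ) < k := by exact_mod_cast hk
    by_cases hRn : ∃ a, a ∉ L ∧ G.Adj b a ∧ R a
    · -- an edge between two vertices that are linked to `L`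
      obtain ⟨a, haL, hba, -, m, hm, ham⟩ := hRn
      have hab : a ≠ b := hba.ne'
      obtain ⟨p, hpC, q, hpL, hqL, hpq, hne1, hne2⟩ := hone a b haL hbL hab
      wlog hRp : R p generalizing p q
      · have hqC := hC p hpC q hpq
        refine this q hqC p hqL hpL hpq.symm (fun h1 h2 => hne2 h2 h1)
          (fun h1 h2 => hne1 h2 h1) ((hCR p q hpC hpL hqL hpq).resolve_left hRp)
      have houta : ∀ v, v ∉ L → G.Adj a v → v = b := by
        intro v hv hav
        by_contra hvb
        exact hF1 v a b l hv haL hbL hvb hl hbl hav.symm hba.symm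
      have houtb : ∀ v, v ∉ L → G.Adj b v → v = a := by
        intro v hv hbv
        by_contra hva
        exact hF1 v b a m hv hbL haL hva hm ham hbv.symm hba
      have hpa : p ≠ a := fun h => hne1 h (houta q hqL (h ▸ hpq))
      have hpb : p ≠ b := fun h => hne2 h (houtb q hqL (h ▸ hpq))
      have hqa : q ≠ a := fun h => hpb (houta p hpL (h ▸ hpq.symm))
      have hqb : q ≠ b := fun h => hpa (houtb p hpL (h ▸ hpq.symm))
      obtain ⟨-, r, hr, hpr⟩ := hRp
      -- Two disjoint edges attached to `L` must be attached at the same vertex and `k ≠ 1`, or a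
      -- path on `2k + 3` vertices appears. So `b` has a single neighbour in `L`, which makes up for
      -- the weight gained from `a`.
      have huniq : ∀ i i', i ∉ L → i' ∉ L → G.Adj i i' → (i ≠ p ∧ i ≠ q ∧ i' ≠ p ∧ i' ≠ q) →
          ∀ s ∈ L, G.Adj i s → s = r ∧ k ≠ 1 := by
        intro i i' hi hi' hii hd s hs his
        by_contra hcon
        obtain ⟨w, hw, hwl⟩ := exists_long_path_of_two_edges hLk hM hLM hii hpq hi hi' hpL hqL
          hd hs hr his hpr (by tauto)
        have := hfree w hw
        omega
      have hub := huniq b a hbL haL hba ⟨hpb.symm, hqb.symm, hpa.symm, hqa.symm⟩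
      have hua := huniq a b haL hbL hba.symm ⟨hpa.symm, hqa.symm, hpb.symm, hqb.symm⟩
      have hk2 : 2 ≤ k := by
        have := (hub l hl hbl).2
        omega
      have hd1 : dL b ≤ 1 := by
        refine Finset.card_le_one.2 fun s hs t ht => ?_
        rw [Finset.mem_filter] at hs ht
        rw [(hub s hs.1 hs.2).1, (hub t ht.1 ht.2).1]
      have hout : ∀ i j, j ∉ L → (∀ v, v ∉ L → G.Adj i v → v = j) →
          c * x i ≤ X + x j := by
        intro i j hj hi
        rw [hsplit i]
        refine add_le_add (hLle i) ?_
        rw [← Finset.sum_filter]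
        calc _ ≤ ∑ v ∈ {j}, x v := Finset.sum_le_sum_of_subset_of_nonneg (by
                intro v hv
                rw [Finset.mem_filter, Finset.mem_compl] at hv
                exact Finset.mem_singleton.2 (hi v hv.1 hv.2)) fun v _ _ => h0 v
          _ = x j := Finset.sum_singleton _ _
      have e1 := hout b a haL houtb
      have e2 := hout a b hbL houta
      have hle : c * x b ≤ k * X := by
        have h2k : (2 : ℝ) ≤ k := by exact_mod_cast hk2
        have h3 : (c - 1) * x b ≤ X := by
          have : (c + 1) * ((c - 1) * x b) ≤ (c + 1) * X := by nlinarith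
          exact le_of_mul_le_mul_left this (by linarith)
        nlinarith [h0 b]
      have hT1 : (1 : ℝ) ≤ (T b).card := by
        exact_mod_cast (hTcard b) ▸ Nat.le_add_left 1 _
      have hKX : 0 ≤ k * X / c := by positivity
      calc (dL b : ℝ) * x b ≤ 1 * x b :=
            mul_le_mul_of_nonneg_right (by exact_mod_cast hd1) (h0 b)
        _ ≤ k * X / c := by rw [one_mul, le_div_iff₀ hc0]; linarith
        _ ≤ (T b).card * (k * X / c) := by nlinarith
    · push Not at hRn
      set t := (Q b).card with ht
      -- Here `b` is the centre of a star: a neighbour outside `L` is not attached to `L`, so by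
      -- `hF1` its only neighbour is `b`.
      have hQx : ∀ e ∈ Q b, c * x e = x b := by
        intro e heQ
        rw [Finset.mem_filter, Finset.mem_compl] at heQ
        obtain ⟨heL, hbe, hRe⟩ := heQ
        rw [hsplit e]
        have z1 : ∑ l ∈ L, (if G.Adj e l then x l else 0) = 0 :=
          Finset.sum_eq_zero fun l hl => if_neg fun h => hRe ⟨heL, l, hl, h⟩
        have z2 : ∑ j ∈ Lᶜ, (if G.Adj e j then x j else 0) = x b := by
          rw [Finset.sum_eq_single b]
          · exact if_pos hbe.symm
          · intro j hj hjb
            refine if_neg fun h => ?_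
            exact hF1 j e b l (Finset.mem_compl.1 hj) heL hbL hjb hl hbl h.symm hbe.symm
          · intro h; exact absurd (Finset.mem_compl.2 hbL) h
        rw [z1, z2, zero_add]
      have hmain : c * (c * x b) ≤ c * X + t * x b := by
        have z3 : ∑ j ∈ Lᶜ, (if G.Adj b j then x j else 0) = ∑ e ∈ Q b, x e := by
          rw [← Finset.sum_filter]
          refine Finset.sum_congr ?_ fun _ _ => rfl
          ext j
          simp only [Q, Finset.mem_filter, Finset.mem_compl]
          constructor
          · rintro ⟨h1, h2⟩; exact ⟨h1, h2, hRn j h1 h2⟩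
          · rintro ⟨h1, h2, -⟩; exact ⟨h1, h2⟩
        have z4 : c * ∑ e ∈ Q b, x e = t * x b := by
          rw [Finset.mul_sum, Finset.sum_congr rfl hQx, Finset.sum_const, nsmul_eq_mul]
        rw [hsplit b, mul_add, z3, z4]
        have := mul_le_mul_of_nonneg_left (hLle b) hc0.le
        linarith
      have ht1 : (t : ℝ) + 1 ≤ c ^ 2 := by
        have h1 : (T b).card ≤ Lᶜ.card := Finset.card_le_card (hTL b hRb)
        rw [hTcard] at h1
        have h2 : (t : ℝ) + 1 ≤ Fintype.card V - k := by
          rw [← hLc]; exact_mod_cast h1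
        have hk1 : (1 : ℝ) ≤ k := by exact_mod_cast hk
        nlinarith
      have hle : c * x b ≤ (t + 1) * X := by
        have hb0 : 0 ≤ c * x b := mul_nonneg hc0.le (h0 b)
        have ht0 : (0 : ℝ) ≤ t := Nat.cast_nonneg t
        have h3 : (c ^ 2 - t) * (c * x b) ≤ c ^ 2 * X := by nlinarith
        -- The difference of the two sides is `t (c² - t - 1)`, nonnegative by `ht1`.
        have h4 : c ^ 2 ≤ (t + 1) * (c ^ 2 - t) := by nlinarith
        have h5 : (c ^ 2 - t) * (c * x b) ≤ (c ^ 2 - t) * ((t + 1) * X) := by nlinarith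
        exact le_of_mul_le_mul_left h5 (by linarith)
      rw [hTcard]
      push_cast
      calc (dL b : ℝ) * x b ≤ k * x b := hdb
        _ = k * (c * x b) / c := by field_simp
        _ ≤ k * ((t + 1) * X) / c := by gcongr
        _ = (t + 1) * (k * X / c) := by ring
  -- The eigenvalue equations are summed over `L` and counted from the other end of each edge.
  have hsum : c * X = ∑ j ∈ L, dL j * x j + ∑ j ∈ Lᶜ, dL j * x j := by
    rw [Finset.sum_add_sum_compl, hX, Finset.mul_sum]
    calc ∑ l ∈ L, c * x l = ∑ l ∈ L, ∑ j, (if G.Adj j l then x j else 0) := by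
          refine Finset.sum_congr rfl fun l _ => ?_
          rw [← he]
          refine Finset.sum_congr rfl fun j _ => ?_
          simp only [G.adj_comm j l]
      _ = ∑ j, dL j * x j := by
          rw [Finset.sum_comm]
          refine Finset.sum_congr rfl fun j _ => ?_
          rw [← Finset.sum_filter, Finset.sum_const, nsmul_eq_mul]
  have hs1 : ∑ j ∈ L, dL j * x j ≤ (k - 1) * X := by
    rw [hX, Finset.mul_sum]
    refine Finset.sum_le_sum fun j hj => mul_le_mul_of_nonneg_right ?_ (h0 j)
    have : dL j ≤ (L.erase j).card := Finset.card_le_card fun l hl => by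
      rw [Finset.mem_filter] at hl
      exact Finset.mem_erase.2 ⟨hl.2.ne', hl.1⟩
    rw [Finset.card_erase_of_mem hj, hLk] at this
    have h1 : dL j + 1 ≤ k := by omega
    have h2 : (dL j : ℝ) + 1 ≤ k := by exact_mod_cast h1
    linarith
  have hs2 : ∑ j ∈ Lᶜ, dL j * x j ≤ (Fintype.card V - k) * (k * X / c) := by
    have h1 : ∑ j ∈ Lᶜ, dL j * x j = ∑ j ∈ Lᶜ.filter R, dL j * x j := by
      rw [Finset.sum_filter]
      refine Finset.sum_congr rfl fun j hj => ?_
      split_ifs with h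
      · rfl
      · have : dL j = 0 := by
          rw [Finset.card_eq_zero, Finset.filter_eq_empty_iff]
          intro l hl hjl
          exact h ⟨Finset.mem_compl.1 hj, l, hl, hjl⟩
        rw [this]; simp
    rw [h1]
    -- A leaf shared by two attached vertices would be the middle of a path excluded by `hF1`.
    have hdisj : ((Lᶜ.filter R : Finset V) : Set V).PairwiseDisjoint T := by
      intro a ha b hb hab
      have hRa : R a := (Finset.mem_filter.1 ha).2
      have hRb : R b := (Finset.mem_filter.1 hb).2
      rw [Function.onFun, Finset.disjoint_left]
      intro v hva hvb
      rcases Finset.mem_insert.1 hva with rfl | hva <;>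
        rcases Finset.mem_insert.1 hvb with rfl | hvb
      · exact hab rfl
      · exact (Finset.mem_filter.1 hvb).2.2 hRa
      · exact (Finset.mem_filter.1 hva).2.2 hRb
      · rw [Finset.mem_filter, Finset.mem_compl] at hva hvb
        obtain ⟨hbL, l, hl, hbl⟩ := hRb
        exact hF1 a v b l hRa.1 hva.1 hbL hab hl hbl hva.2.1 hvb.2.1.symm
    have h2 : ∑ b ∈ Lᶜ.filter R, (T b).card ≤ Lᶜ.card := by
      rw [← Finset.card_biUnion hdisj]
      refine Finset.card_le_card (Finset.biUnion_subset.2 fun b hb => ?_)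
      exact hTL b (Finset.mem_filter.1 hb).2
    calc _ ≤ ∑ b ∈ Lᶜ.filter R, ((T b).card : ℝ) * (k * X / c) :=
          Finset.sum_le_sum fun b hb => hroot b (Finset.mem_filter.1 hb).2
      _ = ((∑ b ∈ Lᶜ.filter R, (T b).card : ℕ) : ℝ) * (k * X / c) := by
          rw [← Finset.sum_mul]; push_cast; rfl
      _ ≤ (Lᶜ.card : ℝ) * (k * X / c) := by
          refine mul_le_mul_of_nonneg_right (by exact_mod_cast h2) (by positivity)
      _ = _ := by rw [hLc]
  have hfin : c * X ≤ (k - 1) * X + (Fintype.card V - k) * (k * X / c) := by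
    rw [hsum]; exact add_le_add hs1 hs2
  have h5 : c ^ 2 * X ≤ ((k - 1) * c + k * (Fintype.card V - k)) * X := by
    have := mul_le_mul_of_nonneg_left hfin hc0.le
    have e : c * ((k - 1) * X + (Fintype.card V - k) * (k * X / c))
        = ((k - 1) * c + k * (Fintype.card V - k)) * X := by
      field_simp
    rw [e] at this
    nlinarith
  have h6 := le_of_mul_le_mul_right h5 hXpos
  linarith

end Biclique

end Join

/-! ### The extremal graphs: spectral bounds, absence of long paths, and the conclusion. -/

section Extremal

theorem exists_equiv_fin {V : Type*} [Fintype V] {n k : ℕ} (hn : Fintype.card V = n)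
    {L : Finset V} (hL : L.card = k) (hkn : k ≤ n) :
    ∃ e : V ≃ Fin n, ∀ v, (e v).val < k ↔ v ∈ L := by
  classical
  let e0 : V ≃ Fin n := Fintype.equivFinOfCardEq hn
  have hcard : Fintype.card {i : Fin n // e0.symm i ∈ L}
      = Fintype.card {i : Fin n // i.val < k} := by
    have h1 : Fintype.card {i : Fin n // e0.symm i ∈ L} = k := by
      rw [← hL, ← Fintype.card_coe]
      exact Fintype.card_congr (e0.symm.subtypeEquiv fun i => Iff.rfl)
    have h2 : Fintype.card {i : Fin n // i.val < k} = k := by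
      conv_rhs => rw [← Fintype.card_fin k]
      exact Fintype.card_congr
        ⟨fun i => ⟨i.1.1, i.2⟩, fun i => ⟨⟨i.1, i.2.trans_le hkn⟩, i.2⟩, fun _ => rfl, fun _ => rfl⟩
    rw [h1, h2]
  let f := Fintype.equivOfCardEq hcard
  refine ⟨e0.trans f.extendSubtype, fun v => ?_⟩
  by_cases hv : v ∈ L
  · simp only [hv, iff_true]
    exact f.extendSubtype_mem (e0 v) (by simpa using hv)
  · simp only [hv, iff_false]
    exact f.extendSubtype_not_mem (e0 v) (by simpa using hv)

theorem exists_equiv_fin_pair {V : Type*} [Fintype V] {n k : ℕ} (hn : Fintype.card V = n)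
    {L : Finset V} (hL : L.card = k) (hkn : k + 2 ≤ n) {a b : V} (ha : a ∉ L) (hb : b ∉ L)
    (hab : a ≠ b) :
    ∃ e : V ≃ Fin n, (∀ v, (e v).val < k ↔ v ∈ L) ∧ (e a).val = k ∧ (e b).val = k + 1 := by
  classical
  obtain ⟨e, he⟩ := exists_equiv_fin hn hL (by omega)
  have hswap : ∀ (p q i : Fin n), ¬ p.val < k → ¬ q.val < k →
      ((Equiv.swap p q i).val < k ↔ i.val < k) := by
    intro p q i hp hq
    rw [Equiv.swap_apply_def]
    split_ifs with h1 h2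
    · subst h1; simp [hp, hq]
    · subst h2; simp [hp, hq]
    · rfl
  let i1 : Fin n := ⟨k, by omega⟩
  let i2 : Fin n := ⟨k + 1, by omega⟩
  let e1 := e.trans (Equiv.swap (e a) i1)
  have he1 : ∀ v, (e1 v).val < k ↔ v ∈ L := fun v => by
    rw [← he v]
    exact hswap _ _ _ (by rw [he]; exact ha) (by simp [i1])
  have he1a : e1 a = i1 := by simp [e1]
  let e2 := e1.trans (Equiv.swap (e1 b) i2)
  have he2a : e2 a = i1 := by
    simp only [e2, Equiv.trans_apply, he1a]
    refine Equiv.swap_apply_of_ne_of_ne ?_ (by simp [i1, i2])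
    rw [← he1a]
    exact fun h => hab (e1.injective h)
  refine ⟨e2, fun v => ?_, by rw [he2a], by simp [e2, i2]⟩
  rw [← he1 v]
  exact hswap _ _ _ (by rw [he1]; exact hb) (by simp [i2])

variable {n k : ℕ}

theorem graphS_adj {i j : Fin n} :
    (graphS n k).Adj i j ↔ i ≠ j ∧ (i.val < k ∨ j.val < k) := by
  simp [graphS, SimpleGraph.fromRel_adj]

theorem graphSPlus_adj {i j : Fin n} :
    (graphSPlus n k).Adj i j ↔ i ≠ j ∧ (i.val < k ∨ j.val < k ∨
      (i.val = k ∧ j.val = k + 1) ∨ (i.val = k + 1 ∧ j.val = k)) := by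
  simp only [graphSPlus, SimpleGraph.sup_adj, graphS_adj, SimpleGraph.fromRel_adj]
  tauto

theorem nonempty_iso_graphS {V : Type*} [Fintype V] (hn : Fintype.card V = n)
    {L : Finset V} (hL : L.card = k) (hkn : k ≤ n) : Nonempty (joinGraph L ≃g graphS n k) := by
  obtain ⟨e, he⟩ := exists_equiv_fin hn hL hkn
  refine ⟨⟨e, ?_⟩⟩
  intro a b
  rw [graphS_adj, he, he, e.injective.ne_iff]
  rfl

theorem nonempty_iso_graphSPlus {V : Type*} [Fintype V] (hn : Fintype.card V = n)
    {L : Finset V} (hL : L.card = k) (hkn : k + 2 ≤ n) {a b : V} (ha : a ∉ L) (hb : b ∉ L)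
    (hab : a ≠ b) : Nonempty (joinPlus L a b ≃g graphSPlus n k) := by
  obtain ⟨e, he, hea, heb⟩ := exists_equiv_fin_pair hn hL hkn ha hb hab
  refine ⟨⟨e, ?_⟩⟩
  intro i j
  have h1 : ∀ v, (e v).val = k ↔ v = a := fun v => by
    rw [← hea, ← Fin.ext_iff, e.injective.eq_iff]
  have h2 : ∀ v, (e v).val = k + 1 ↔ v = b := fun v => by
    rw [← heb, ← Fin.ext_iff, e.injective.eq_iff]
  rw [graphSPlus_adj, he, he, e.injective.ne_iff, h1, h1, h2, h2]
  rfl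

/-- The vector equal to `r` on `L` and `k` elsewhere is an eigenvector for `r`. Only this lower
bound on the spectral radius is needed. -/
theorem le_graphMu_joinGraph {V : Type*} [Fintype V] {L : Finset V} (hL : L.card = k)
    (hk : 1 ≤ k) {r : ℝ} (hr : 0 < r)
    (h : r ^ 2 - (k - 1) * r = k * (Fintype.card V - k)) : r ≤ graphMu (joinGraph L) := by
  classical
  have hk0 : (0 : ℝ) < k := by exact_mod_cast hk
  obtain ⟨l, hl⟩ : L.Nonempty := Finset.card_pos.1 (by omega)
  have hLc : (Lᶜ.card : ℝ) = Fintype.card V - k := by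
    rw [Finset.card_compl, hL, Nat.cast_sub (hL ▸ Finset.card_le_univ L)]
  refine le_graphMu (v := fun i => if i ∈ L then r else k) (fun h0 => ?_) fun i => ?_
  · have := congrFun h0 l
    simp only [hl, if_true, Pi.zero_apply] at this
    exact hr.ne' this
  · simp only [nbrSum]
    by_cases hi : i ∈ L
    · have h1 : ∀ j, (if (joinGraph L).Adj i j then (if j ∈ L then r else (k : ℝ)) else 0)
          = (if j ∈ L then r else (k : ℝ)) - (if i = j then r else 0) := by
        intro j
        by_cases hij : i = j
        · subst hij; simp [hi]
        · have : (joinGraph L).Adj i j := ⟨hij, Or.inl hi⟩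
          simp [this, hij]
      rw [Finset.sum_congr rfl fun j _ => h1 j, Finset.sum_sub_distrib, Finset.sum_ite_eq,
        ← Finset.sum_add_sum_compl L, Finset.sum_congr rfl (g := fun _ => r)
          (fun j hj => if_pos hj), Finset.sum_congr (s₁ := Lᶜ) rfl (g := fun _ => (k : ℝ))
          (fun j hj => if_neg (Finset.mem_compl.1 hj))]
      simp only [Finset.sum_const, nsmul_eq_mul, hL, hLc, Finset.mem_univ, if_true, hi]
      linarith
    · have h1 : ∀ j, (if (joinGraph L).Adj i j then (if j ∈ L then r else (k : ℝ)) else 0)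
          = if j ∈ L then r else 0 := by
        intro j
        by_cases hj : j ∈ L
        · have : (joinGraph L).Adj i j := ⟨fun h => hi (h ▸ hj), Or.inr hj⟩
          simp [this, hj]
        · have : ¬ (joinGraph L).Adj i j := fun h => h.2.elim hi hj
          simp [this, hj]
      rw [Finset.sum_congr rfl fun j _ => h1 j, Finset.sum_ite_mem, Finset.univ_inter]
      simp only [Finset.sum_const, nsmul_eq_mul, hL, hi, if_false]
      ring

theorem exists_le_graphMu_graphS (hk : 1 ≤ k) (hkn : k < n) :
    ∃ r : ℝ, 0 < r ∧ (k : ℝ) - 1 ≤ r ∧ r ^ 2 - (k - 1) * r = k * (n - k) ∧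
      r ≤ graphMu (graphS n k) := by
  have hk1 : (1 : ℝ) ≤ k := by exact_mod_cast hk
  have hkn' : (k : ℝ) < n := by exact_mod_cast hkn
  set d : ℝ := ((k : ℝ) - 1) ^ 2 + 4 * k * (n - k) with hd
  have hpos : 0 < 4 * (k : ℝ) * (n - k) := by
    have : (0 : ℝ) < n - k := by linarith
    positivity
  have hd0 : 0 < d := by positivity
  have hs : Real.sqrt d ^ 2 = d := Real.sq_sqrt hd0.le
  have hs0 : 0 < Real.sqrt d := Real.sqrt_pos.2 hd0
  have hs1 : (k : ℝ) - 1 ≤ Real.sqrt d := Real.le_sqrt_of_sq_le (by rw [hd]; linarith)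
  have hr0 : 0 < ((k : ℝ) - 1 + Real.sqrt d) / 2 := by linarith
  have hr : (((k : ℝ) - 1 + Real.sqrt d) / 2) ^ 2 - (k - 1) * (((k : ℝ) - 1 + Real.sqrt d) / 2)
      = k * (n - k) := by nlinarith
  refine ⟨((k : ℝ) - 1 + Real.sqrt d) / 2, hr0, by linarith, hr, ?_⟩
  obtain ⟨L, -, hL⟩ := Finset.exists_subset_card_eq (s := (Finset.univ : Finset (Fin n)))
    (n := k) (by simpa using hkn.le)
  obtain ⟨e⟩ := nonempty_iso_graphS (Fintype.card_fin n) hL hkn.le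
  rw [← graphMu_congr e]
  exact le_graphMu_joinGraph hL hk hr0 (by rw [hr, Fintype.card_fin])

/-- The quadratic `c² - (k-1) c` is increasing beyond its root value `r`, as `r ≥ k - 1`. -/
theorem le_of_graphMu_graphS_le (hk : 1 ≤ k) (hkn : k < n) {c : ℝ}
    (h : graphMu (graphS n k) ≤ c) : (k : ℝ) * (n - k) ≤ c ^ 2 - (k - 1) * c := by
  obtain ⟨r, hr0, hr1, hr, hle⟩ := exists_le_graphMu_graphS hk hkn
  have h1 : r ≤ c := hle.trans h
  nlinarith [mul_nonneg (sub_nonneg.2 h1) (by linarith : (0 : ℝ) ≤ c + r - (k - 1))]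

theorem lt_of_graphMu_graphS_lt (hk : 1 ≤ k) (hkn : k < n) {c : ℝ}
    (h : graphMu (graphS n k) < c) : (k : ℝ) * (n - k) < c ^ 2 - (k - 1) * c := by
  obtain ⟨r, hr0, hr1, hr, hle⟩ := exists_le_graphMu_graphS hk hkn
  have h1 : r < c := hle.trans_lt h
  nlinarith [mul_pos (sub_pos.2 h1) (by linarith : (0 : ℝ) < c + r - (k - 1))]

/-- Otherwise `eq_of_support_le` would identify the two graphs, but they differ in the added edge.
-/
theorem graphMu_graphS_lt_graphSPlus (hk : 1 ≤ k) (hkn : k + 2 ≤ n) :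
    graphMu (graphS n k) < graphMu (graphSPlus n k) := by
  by_contra! hcon
  have : Nonempty (Fin n) := ⟨⟨0, by omega⟩⟩
  obtain ⟨x, h0, hx, he⟩ := exists_perron_vector (graphS n k)
  have h := eq_of_support_le (G := graphS n k) (K := graphSPlus n k) (l := ⟨0, by omega⟩)
    (fun j hj => graphSPlus_adj.2 ⟨hj.symm, Or.inl hk⟩) hcon h0 hx he
    (fun i j _ _ hij => Or.inl hij)
  have h1 : (graphSPlus n k).Adj ⟨k, by omega⟩ ⟨k + 1, by omega⟩ :=
    graphSPlus_adj.2 ⟨by simp, by simp⟩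
  rw [← h, graphS_adj] at h1
  simp at h1

open Classical in
-- On a path, two consecutive vertices outside `L` must be `a` and `b`, which happens at most once.
-- The second clause, for paths starting in `L`, strengthens the induction; allowing `a = b` treats
-- both extremal graphs at once.
theorem countP_le_of_isChain {V : Type*} (L : Finset V) (a b : V) : ∀ l : List V, l.Nodup →
    l.IsChain (joinPlus L a b).Adj →
    l.countP (· ∉ L) ≤ l.countP (· ∈ L) + 1 + (if a ≠ b ∧ a ∈ l ∧ b ∈ l then 1 else 0) ∧
    ∀ h ∈ l.head?, h ∈ L →
      l.countP (· ∉ L) ≤ l.countP (· ∈ L) + (if a ≠ b ∧ a ∈ l ∧ b ∈ l then 1 else 0) := by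
  intro l
  induction l with
  | nil => simp
  | cons x l ih =>
    intro hnd hch
    rw [List.nodup_cons] at hnd
    obtain ⟨ih1, ih2⟩ := ih hnd.2 hch.tail
    have hmono : (if a ≠ b ∧ a ∈ l ∧ b ∈ l then 1 else 0)
        ≤ (if a ≠ b ∧ a ∈ x :: l ∧ b ∈ x :: l then 1 else 0) := by
      split_ifs with h1 h2 h2
      · rfl
      · exact absurd ⟨h1.1, List.mem_cons_of_mem _ h1.2.1, List.mem_cons_of_mem _ h1.2.2⟩ h2
      · simp
      · rfl
    by_cases hx : x ∈ L
    · simp only [List.countP_cons, hx, not_true_eq_false, decide_false, decide_true,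
        if_true, Bool.false_eq_true, if_false]
      refine ⟨by omega, fun _ _ _ => by omega⟩
    · refine ⟨?_, fun h hh hL => ?_⟩
      · simp only [List.countP_cons, hx, not_false_eq_true, decide_false, decide_true,
          if_true, Bool.false_eq_true, if_false]
        match l, hnd, hch, ih1, ih2, hmono with
        | [], _, _, _, _, _ => simp
        | y :: l, hnd, hch, ih1, ih2, hmono =>
          by_cases hy : y ∈ L
          · have := ih2 y (by simp) hy
            omega
          · have hxy := (List.isChain_cons_cons.1 hch).1
            have hne := hxy.1
            have hab := (hxy.2.resolve_left hx).resolve_left hy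
            have e1 : (if a ≠ b ∧ a ∈ y :: l ∧ b ∈ y :: l then 1 else 0) = 0 := by
              refine if_neg fun h => ?_
              rcases hab with ⟨rfl, rfl⟩ | ⟨rfl, rfl⟩
              · exact hnd.1 h.2.1
              · exact hnd.1 h.2.2
            have e2 : (if a ≠ b ∧ a ∈ x :: y :: l ∧ b ∈ x :: y :: l then 1 else 0) = 1 := by
              refine if_pos ?_
              rcases hab with ⟨rfl, rfl⟩ | ⟨rfl, rfl⟩
              · exact ⟨hne, by simp, by simp⟩
              · exact ⟨hne.symm, by simp, by simp⟩
            omega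
      · simp only [List.head?_cons, Option.mem_def, Option.some.injEq] at hh
        exact absurd (hh ▸ hL) hx

open Classical in
theorem PathList.length_le {V : Type*} {L : Finset V} {a b : V} {l : List V}
    (hl : PathList (joinPlus L a b) l) :
    l.length ≤ 2 * L.card + 1 + (if a ≠ b then 1 else 0) := by
  have h1 := (countP_le_of_isChain L a b l hl.1 hl.2).1
  have h2 : l.countP (· ∈ L) ≤ L.card := by
    rw [List.countP_eq_length_filter, ← List.toFinset_card_of_nodup (hl.1.filter _)]
    refine Finset.card_le_card fun v hv => ?_
    simpa using (List.mem_filter.1 (List.mem_toFinset.1 hv)).2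
  have h3 := List.length_eq_countP_add_countP (l := l) (fun v => decide (v ∈ L))
  have h4 : l.countP (fun v => ¬ decide (v ∈ L)) = l.countP (· ∉ L) := by
    congr 1; funext v; simp
  have h5 : (if a ≠ b ∧ a ∈ l ∧ b ∈ l then 1 else 0) ≤ (if a ≠ b then 1 else 0) := by
    split_ifs <;> simp_all
  omega

theorem graphS_not_containsPath (hk : 1 ≤ k) (hkn : k ≤ n) :
    ¬ ContainsPath (2 * k + 2) (graphS n k) := by
  intro h
  obtain ⟨l, hl, hlen⟩ := h.exists_pathList
  have hL : (Finset.univ.filter fun i : Fin n => i.val < k).card = k := by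
    rw [Fin.card_filter_val_lt]; omega
  -- Equal endpoints add no edge, so this is the plain join and the extra `1` in the bound vanishes.
  have := (hl.mono (G := joinPlus (Finset.univ.filter fun i : Fin n => i.val < k)
    ⟨0, by omega⟩ ⟨0, by omega⟩) fun i j hij => by
      rw [graphS_adj] at hij
      exact ⟨hij.1, by simpa using hij.2.imp id Or.inl⟩).length_le
  rw [hL] at this
  simp at this
  omega

theorem graphSPlus_not_containsPath (hkn : k + 2 ≤ n) :
    ¬ ContainsPath (2 * k + 3) (graphSPlus n k) := by
  intro h
  obtain ⟨l, hl, hlen⟩ := h.exists_pathList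
  have hL : (Finset.univ.filter fun i : Fin n => i.val < k).card = k := by
    rw [Fin.card_filter_val_lt]; omega
  have := (hl.mono (G := joinPlus (Finset.univ.filter fun i : Fin n => i.val < k)
    ⟨k, by omega⟩ ⟨k + 1, by omega⟩) fun i j hij => by
      rw [graphSPlus_adj] at hij
      exact ⟨hij.1, by simpa [Fin.ext_iff] using hij.2⟩).length_le
  rw [hL] at this
  simp at this
  omega

variable {V : Type*} [Fintype V] {G : SimpleGraph V}

theorem exists_biclique_of_graphMu (hk : 1 ≤ k) (hn : 2 ^ (4 * k) ≤ Fintype.card V)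
    (hc0 : 0 ≤ graphMu G)
    (hc : (k : ℝ) * (Fintype.card V - k) ≤ graphMu G ^ 2 - (k - 1) * graphMu G)
    (hfree : ∀ l, PathList G l → l.length ≤ 2 * k + 2) :
    ∃ (x : V → ℝ) (u : V) (L M : Finset V), (∀ i, 0 ≤ x i) ∧
      (∀ i, nbrSum G x i = graphMu G * x i) ∧ 0 < x u ∧ L.card = k ∧ k + 3 ≤ M.card ∧
      (∀ l ∈ L, ∀ m ∈ M, G.Adj l m) ∧
      ∀ C : Set V, (∀ a ∈ C, ∀ b, G.Adj a b → b ∈ C) → (∀ l ∈ L, l ∈ C) → u ∈ C := by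
  classical
  have : Nonempty V := Fintype.card_pos_iff.1 (lt_of_lt_of_le (by positivity) hn)
  obtain ⟨x, h0, hx, he⟩ := exists_perron_vector G
  -- For `k = 1` the star at a vertex of degree at least `c > 3` already serves as the biclique.
  rcases hk.eq_or_lt with rfl | hk2
  · obtain ⟨u, hxu, hu⟩ := exists_le_nbrSum_one h0 hx he
    refine ⟨x, u, {u}, Finset.univ.filter fun v => G.Adj u v, h0, he, hxu, by simp, ?_, ?_, ?_⟩
    · have hn' : (16 : ℝ) ≤ Fintype.card V := by exact_mod_cast hn
      rw [nbrSum_one] at hu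
      have h3 : (3 : ℝ) < graphMu G := by
        push_cast at hc
        nlinarith
      have : (3 : ℝ) < deg G u := h3.trans_le hu
      have h4 : 3 < deg G u := by exact_mod_cast this
      unfold deg at h4
      exact h4
    · intro l hl m hm
      rw [Finset.mem_singleton.1 hl]
      exact (Finset.mem_filter.1 hm).2
    · intro C _ hL
      exact hL u (Finset.mem_singleton_self u)
  · obtain ⟨u, hxu, hu⟩ := exists_le_nbrSum_nbrSum_one h0 hx he ((k : ℝ) - 1)
    obtain ⟨L, M, hL, hM, hLM, hC⟩ := exists_biclique hk2 hn (hc.trans hu) hfree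
    exact ⟨x, u, L, M, h0, he, hxu, hL, hM, hLM, hC⟩

theorem add_fifteen_le_of_pow_le (hk : 1 ≤ k) (hn : 2 ^ (4 * k) ≤ n) : k + 15 ≤ n := by
  refine le_trans ?_ hn
  clear hn
  induction k, hk using Nat.le_induction with
  | base => norm_num
  | succ m hm ih => rw [show 4 * (m + 1) = 4 * m + 4 by ring, pow_add]; omega

theorem containsPath_of_graphS (hk : 1 ≤ k) (hn : 2 ^ (4 * k) ≤ n) (hV : Fintype.card V = n)
    (hmu : graphMu (graphS n k) ≤ graphMu G) (hiso : ¬ Nonempty (G ≃g graphS n k)) :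
    ContainsPath (2 * k + 2) G := by
  by_contra hcon
  have hkn := add_fifteen_le_of_pow_le hk hn
  have hfree : ∀ l, PathList G l → l.length ≤ 2 * k + 1 := by
    intro l hl
    by_contra! h
    exact hcon (hl.containsPath h)
  obtain ⟨r, hr0, -, -, hr⟩ := exists_le_graphMu_graphS hk (show k < n by omega)
  have hc := le_of_graphMu_graphS_le hk (by omega) hmu
  rw [← hV] at hc
  obtain ⟨x, u, L, M, h0, he, hxu, hL, hM, hLM, hu⟩ := exists_biclique_of_graphMu hk
    (hV.symm ▸ hn) (hr0.le.trans (hr.trans hmu)) hc fun l hl => (hfree l hl).trans (by omega)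
  obtain ⟨e⟩ := nonempty_iso_graphS hV hL (by omega)
  have h := eq_joinGraph hL hM hLM h0 he hxu hu hk (by rwa [graphMu_congr e]) hfree
  exact hiso (h ▸ ⟨e⟩)

theorem containsPath_of_graphSPlus (hk : 1 ≤ k) (hn : 2 ^ (4 * k) ≤ n)
    (hV : Fintype.card V = n) (hmu : graphMu (graphSPlus n k) ≤ graphMu G)
    (hiso : ¬ Nonempty (G ≃g graphSPlus n k)) : ContainsPath (2 * k + 3) G := by
  by_contra hcon
  have hkn := add_fifteen_le_of_pow_le hk hn
  have hfree : ∀ l, PathList G l → l.length ≤ 2 * k + 2 := by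
    intro l hl
    by_contra! h
    exact hcon (hl.containsPath h)
  obtain ⟨r, hr0, -, -, hr⟩ := exists_le_graphMu_graphS hk (show k < n by omega)
  have hlt := (graphMu_graphS_lt_graphSPlus hk (show k + 2 ≤ n by omega)).trans_le hmu
  have hc := lt_of_graphMu_graphS_lt hk (by omega) hlt
  have hc0 : 0 < graphMu G := hr0.trans_le (hr.trans hlt.le)
  have hc2 : 2 ≤ graphMu G := by
    have h1 : (1 : ℝ) ≤ k := by exact_mod_cast hk
    have h2 : (k : ℝ) + 15 ≤ n := by exact_mod_cast hkn
    nlinarith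
  rw [← hV] at hc
  obtain ⟨x, u, L, M, h0, he, hxu, hL, hM, hLM, hu⟩ := exists_biclique_of_graphMu hk
    (hV.symm ▸ hn) hc0.le hc.le hfree
  obtain ⟨a, b, ha, hb, hab, h⟩ := eq_joinPlus hL hM hLM h0 he hxu hu hk hc2 hc
    (fun a b ha hb hab => by
      obtain ⟨e⟩ := nonempty_iso_graphSPlus hV hL (by omega) ha hb hab
      rwa [graphMu_congr e]) hfree
  obtain ⟨e⟩ := nonempty_iso_graphSPlus hV hL (by omega) ha hb hab
  exact hiso (h ▸ ⟨e⟩)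

end Extremal

theorem theorem1 (k n : ℕ) (hk : 1 ≤ k) (hn : 2 ^ (4 * k) ≤ n) :
    (∀ (V : Type*) [Fintype V] (G : SimpleGraph V), Fintype.card V = n →
      (graphMu (graphS n k) ≤ graphMu G →
        ¬ Nonempty (G ≃g graphS n k) → ContainsPath (2 * k + 2) G) ∧
      (graphMu (graphSPlus n k) ≤ graphMu G →
        ¬ Nonempty (G ≃g graphSPlus n k) → ContainsPath (2 * k + 3) G)) ∧
    IsGreatest (pathFreeMuSet (2 * k + 2) n) (graphMu (graphS n k)) ∧
    IsGreatest (pathFreeMuSet (2 * k + 3) n) (graphMu (graphSPlus n k)) := by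
  have hkn := add_fifteen_le_of_pow_le hk hn
  refine ⟨fun V _ G hV => ⟨containsPath_of_graphS hk hn hV, containsPath_of_graphSPlus hk hn hV⟩,
    ⟨⟨graphS n k, graphS_not_containsPath hk (by omega), rfl⟩, ?_⟩,
    ⟨⟨graphSPlus n k, graphSPlus_not_containsPath (by omega), rfl⟩, ?_⟩⟩
  · rintro _ ⟨G, hG, rfl⟩
    by_contra! h
    exact hG (containsPath_of_graphS hk hn (Fintype.card_fin n) h.le
      fun ⟨e⟩ => h.ne' (graphMu_congr e))
  · rintro _ ⟨G, hG, rfl⟩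
    by_contra! h
    exact hG (containsPath_of_graphSPlus hk hn (Fintype.card_fin n) h.le
      fun ⟨e⟩ => h.ne' (graphMu_congr e))
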